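/- Let $R$ be a field and let $q\in R$ be non-zero and not a root of unity (for instance $R=\mathbb R$ and $0<q<1$). For $m\in\mathbb Z$ let $(a;q)_m=\prod_{j=0}^{m-1}(1-aq^j)$ if $m\ge 0$ and $(a;q)_m=\prod_{j=1}^{-m}(1-aq^{-j})^{-1}$ if $m<0$, with the convention $1/(q;q)_m=0$ for $m<0$. For $\kappa\in\mathbb Z^n$ put $|\kappa|=\kappa_1+\dots+\kappa_n$, and write $\beta\ge\kappa$ if $\beta_i\ge\kappa_i$ for all $i$. In products written with a slash, everything after the slash is in the denominator, e.g. $qu_i/t^2u_0=qu_i/(t^2u_0)$. Let $t,u_0,u_1,\dots,u_n$ be indeterminates over $R$ (more generally, elements of an extension field of $R$ that are algebraically independent over $R$), and let $r,k$ be integers with $r\ge 0$ and $1\le k\le n+1$. For $\beta,\kappa,\gamma\in\mathbb Z^n$ define \begin{align*} f_{\beta\kappa}={}&q^{|\beta|-|\kappa|}\,\frac{(t^2u_0;q)_{|\beta|}}{(qtu_0;q)_{|\beta|}}\,\frac{(qtu_0;q)_{|\kappa|}}{(t^2u_0;q)_{|\kappa|}}\,\prod_{i=1}^n\frac{(q/t;q)_{\beta_i-\kappa_i}}{(q;q)_{\beta_i-\kappa_i}}\,\frac{(q^{\kappa_i+|\kappa|+1}u_i;q)_{\beta_i-\kappa_i}}{(q^{\kappa_i+|\kappa|+1}tu_i;q)_{\beta_i-\kappa_i}}\\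 &\times\prod_{i=1}^{k-1}\frac{(u_i/tu_0;q)_{\beta_i}}{(qu_i/t^2u_0;q)_{\beta_i}}\,\frac{(qu_i/tu_0;q)_{\kappa_i}}{(u_i/u_0;q)_{\kappa_i}}\,\frac{(u_i/u_0;q)_{|\kappa|-r+\kappa_i}}{(qu_i/tu_0;q)_{|\kappa|-r+\kappa_i}}\,\frac{(qu_i/t^2u_0;q)_{|\kappa|-r+\kappa_i}}{(u_i/tu_0;q)_{|\kappa|-r+\kappa_i}}\\ &\times\prod_{i=k}^n\frac{(tu_i/u_0;q)_{\beta_i}}{(qu_i/u_0;q)_{\beta_i}}\,\frac{(qu_i/u_0;q)_{\kappa_i}}{(tu_i/u_0;q)_{\kappa_i}}\\ &\times\prod_{1\le i<j\le n}\frac{(q^{\beta_i-\beta_j+1}u_i/tu_j;q)_{\beta_j-\kappa_j}}{(q^{\beta_i-\beta_j+1}u_i/u_j;q)_{\beta_j-\kappa_j}}\,\frac{(q^{\kappa_i-\beta_j}tu_i/u_j;q)_{\beta_j-\kappa_j}}{(q^{\kappa_i-\beta_j}u_i/u_j;q)_{\beta_j-\kappa_j}}\,\big(q^{\beta_i}u_i-q^{\beta_j}u_j\big)^{-1}\\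 &\times\det_{1\le i,j\le n}\left[\big(q^{\beta_i}u_i\big)^{n-j}\left(1-t^{j-1}\,\frac{1-q^{\beta_i+|\kappa|}tu_i}{1-q^{\beta_i+|\kappa|}u_i}\prod_{s=1}^n\frac{q^{\beta_i}u_i-q^{\kappa_s}u_s}{q^{\beta_i}u_i-q^{\kappa_s}tu_s}\right)\right] \end{align*} and \begin{align*} g_{\kappa\gamma}={}&\Big(\frac qt\Big)^{|\kappa|-|\gamma|}\,\frac{(t^2u_0;q)_{|\kappa|}}{(qtu_0;q)_{|\kappa|}}\,\frac{(qtu_0;q)_{|\gamma|}}{(t^2u_0;q)_{|\gamma|}}\,\prod_{i=1}^n\frac{(t;q)_{\kappa_i-\gamma_i}}{(q;q)_{\kappa_i-\gamma_i}}\,\frac{(q^{\gamma_i+|\kappa|+1}u_i;q)_{\kappa_i-\gamma_i}}{(q^{\gamma_i+|\kappa|}tu_i;q)_{\kappa_i-\gamma_i}}\\ &\times\prod_{i=1}^{k-1}\frac{(u_i/u_0;q)_{\kappa_i}}{(qu_i/tu_0;q)_{\kappa_i}}\,\frac{(qu_i/t^2u_0;q)_{\gamma_i}}{(u_i/tu_0;q)_{\gamma_i}}\,\frac{(qu_i/tu_0;q)_{|\kappa|-r+\kappa_i}}{(u_i/u_0;q)_{|\kappa|-r+\kappa_i}}\,\frac{(u_i/tu_0;q)_{|\kappa|-r+\kappa_i}}{(qu_i/t^2u_0;q)_{|\kappa|-r+\kappa_i}}\\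 &\times\prod_{i=k}^n\frac{(tu_i/u_0;q)_{\kappa_i}}{(qu_i/u_0;q)_{\kappa_i}}\,\frac{(qu_i/u_0;q)_{\gamma_i}}{(tu_i/u_0;q)_{\gamma_i}}\\ &\times\prod_{1\le i<j\le n}\frac{(q^{\kappa_i-\kappa_j}tu_i/u_j;q)_{\kappa_j-\gamma_j}}{(q^{\kappa_i-\kappa_j+1}u_i/u_j;q)_{\kappa_j-\gamma_j}}\,\frac{(q^{\gamma_i-\kappa_j+1}u_i/tu_j;q)_{\kappa_j-\gamma_j}}{(q^{\gamma_i-\kappa_j}u_i/u_j;q)_{\kappa_j-\gamma_j}}. \end{align*} Then the infinite $n$-dimensional matrices $(f_{\beta\kappa})_{\beta,\kappa\in\mathbb Z^n}$ and $(g_{\kappa\gamma})_{\kappa,\gamma\in\mathbb Z^n}$ are lower-triangular ($f_{\beta\kappa}=g_{\beta\kappa}=0$ unless $\beta\ge\kappa$), have non-zero diagonal entries, and are mutually inverse: for all $\beta,\gamma\in\mathbb Z^n$, $$\sum_{\beta\ge\kappa\ge\gamma}f_{\beta\kappa}\,g_{\kappa\gamma}=\delta_{\beta\gamma}=\sum_{\beta\ge\kappa\ge\gamma}g_{\beta\kappa}\,f_{\kappa\gamma}.$$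 -/

import Mathlib

noncomputable section

namespace QInverse

variable {K : Type*} [Field K]

/-- The `q`-shifted factorial `(a;q)_m` for an integer `m`, that is, the quotient
`(a;q)_∞ / (a q^m;q)_∞`: it equals `∏_{0 ≤ j < m} (1 - a q^j)` for `m ≥ 0` and
`1 / ∏_{1 ≤ j ≤ -m} (1 - a q^{-j})` for `m < 0`. -/
def qPoch (q a : K) : ℤ → K
  | Int.ofNat m => ∏ j ∈ Finset.range m, (1 - a * q ^ j)
  | Int.negSucc m => (∏ j ∈ Finset.range (m + 1), (1 - a * q ^ (-((j : ℤ) + 1))))⁻¹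

/-- The reciprocal `1 / (q;q)_m = (q^{m+1};q)_∞ / (q;q)_∞` for an integer `m`.
It is `0` for `m < 0`, since then `(q^{m+1};q)_∞` contains the factor `1 - q^0`. -/
def qPochSelfRecip (q : K) (m : ℤ) : K :=
  if 0 ≤ m then (qPoch q q m)⁻¹ else 0

/-- `|κ| = κ_1 + ⋯ + κ_n`. -/
def size {n : ℕ} (κ : Fin n → ℤ) : ℤ := ∑ i, κ i

/-- The matrix `f_{βκ}`. The index `i : Fin n` stands for the index `i + 1` of the usual
numbering `1, …, n`; so the range `1 ≤ i ≤ k - 1` reads `i + 1 < k`, the range `k ≤ i ≤ n`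
reads `k ≤ i + 1`, and in the determinant the exponents `n - j` and `j - 1` read
`n - 1 - j` and `j`. -/
def f {n : ℕ} (q t u₀ : K) (u : Fin n → K) (r k : ℕ) (β κ : Fin n → ℤ) : K :=
  q ^ (size β - size κ)
  * (qPoch q (t ^ 2 * u₀) (size β) / qPoch q (q * t * u₀) (size β))
  * (qPoch q (q * t * u₀) (size κ) / qPoch q (t ^ 2 * u₀) (size κ))
  * (∏ i : Fin n,
      (qPoch q (q / t) (β i - κ i) * qPochSelfRecip q (β i - κ i))
      * (qPoch q (q ^ (κ i + size κ + 1) * u i) (β i - κ i)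
          / qPoch q (q ^ (κ i + size κ + 1) * t * u i) (β i - κ i)))
  * (∏ i ∈ Finset.univ.filter (fun i : Fin n => (i : ℕ) + 1 < k),
      (qPoch q (u i / (t * u₀)) (β i) / qPoch q (q * u i / (t ^ 2 * u₀)) (β i))
      * (qPoch q (q * u i / (t * u₀)) (κ i) / qPoch q (u i / u₀) (κ i))
      * (qPoch q (u i / u₀) (size κ - r + κ i)
          / qPoch q (q * u i / (t * u₀)) (size κ - r + κ i))
      * (qPoch q (q * u i / (t ^ 2 * u₀)) (size κ - r + κ i)
          / qPoch q (u i / (t * u₀)) (size κ - r + κ i)))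
  * (∏ i ∈ Finset.univ.filter (fun i : Fin n => k ≤ (i : ℕ) + 1),
      (qPoch q (t * u i / u₀) (β i) / qPoch q (q * u i / u₀) (β i))
      * (qPoch q (q * u i / u₀) (κ i) / qPoch q (t * u i / u₀) (κ i)))
  * (∏ i : Fin n, ∏ j ∈ Finset.Ioi i,
      (qPoch q (q ^ (β i - β j + 1) * u i / (t * u j)) (β j - κ j)
          / qPoch q (q ^ (β i - β j + 1) * u i / u j) (β j - κ j))
      * (qPoch q (q ^ (κ i - β j) * t * u i / u j) (β j - κ j)
          / qPoch q (q ^ (κ i - β j) * u i / u j) (β j - κ j))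
      * (q ^ β i * u i - q ^ β j * u j)⁻¹)
  * Matrix.det (Matrix.of fun i j : Fin n =>
      (q ^ β i * u i) ^ (n - 1 - (j : ℕ))
      * (1 - t ^ (j : ℕ)
          * ((1 - q ^ (β i + size κ) * t * u i) / (1 - q ^ (β i + size κ) * u i))
          * ∏ s : Fin n, (q ^ β i * u i - q ^ κ s * u s) / (q ^ β i * u i - q ^ κ s * t * u s)))

/-- The matrix `g_{κγ}`, with the same conventions on indices. -/
def g {n : ℕ} (q t u₀ : K) (u : Fin n → K) (r k : ℕ) (κ γ : Fin n → ℤ) : K :=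
  (q / t) ^ (size κ - size γ)
  * (qPoch q (t ^ 2 * u₀) (size κ) / qPoch q (q * t * u₀) (size κ))
  * (qPoch q (q * t * u₀) (size γ) / qPoch q (t ^ 2 * u₀) (size γ))
  * (∏ i : Fin n,
      (qPoch q t (κ i - γ i) * qPochSelfRecip q (κ i - γ i))
      * (qPoch q (q ^ (γ i + size κ + 1) * u i) (κ i - γ i)
          / qPoch q (q ^ (γ i + size κ) * t * u i) (κ i - γ i)))
  * (∏ i ∈ Finset.univ.filter (fun i : Fin n => (i : ℕ) + 1 < k),
      (qPoch q (u i / u₀) (κ i) / qPoch q (q * u i / (t * u₀)) (κ i))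
      * (qPoch q (q * u i / (t ^ 2 * u₀)) (γ i) / qPoch q (u i / (t * u₀)) (γ i))
      * (qPoch q (q * u i / (t * u₀)) (size κ - r + κ i)
          / qPoch q (u i / u₀) (size κ - r + κ i))
      * (qPoch q (u i / (t * u₀)) (size κ - r + κ i)
          / qPoch q (q * u i / (t ^ 2 * u₀)) (size κ - r + κ i)))
  * (∏ i ∈ Finset.univ.filter (fun i : Fin n => k ≤ (i : ℕ) + 1),
      (qPoch q (t * u i / u₀) (κ i) / qPoch q (q * u i / u₀) (κ i))
      * (qPoch q (q * u i / u₀) (γ i) / qPoch q (t * u i / u₀) (γ i)))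
  * (∏ i : Fin n, ∏ j ∈ Finset.Ioi i,
      (qPoch q (q ^ (κ i - κ j) * t * u i / u j) (κ j - γ j)
          / qPoch q (q ^ (κ i - κ j + 1) * u i / u j) (κ j - γ j))
      * (qPoch q (q ^ (γ i - κ j + 1) * u i / (t * u j)) (κ j - γ j)
          / qPoch q (q ^ (γ i - κ j) * u i / u j) (κ j - γ j)))

/-- An infinite `n`-dimensional matrix is lower-triangular if `F_{βκ} = 0` unless `β ≥ κ`
(componentwise). -/
def IsLowerTriangular {n : ℕ} (F : (Fin n → ℤ) → (Fin n → ℤ) → K) : Prop :=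
  ∀ β κ, ¬ κ ≤ β → F β κ = 0

/-- Two infinite `n`-dimensional matrices are mutually inverse: both are lower-triangular
with non-zero diagonal entries, and
`∑_{β ≥ κ ≥ γ} F_{βκ} G_{κγ} = δ_{βγ} = ∑_{β ≥ κ ≥ γ} G_{βκ} F_{κγ}` for all `β`, `γ`. -/
structure AreMutuallyInverse {n : ℕ} (F G : (Fin n → ℤ) → (Fin n → ℤ) → K) : Prop where
  lower_left : IsLowerTriangular F
  lower_right : IsLowerTriangular G
  diag_left : ∀ κ, F κ κ ≠ 0
  diag_right : ∀ κ, G κ κ ≠ 0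
  mul_eq : ∀ β γ, ∑ κ ∈ Finset.Icc γ β, F β κ * G κ γ = if β = γ then 1 else 0
  mul_eq' : ∀ β γ, ∑ κ ∈ Finset.Icc γ β, G β κ * F κ γ = if β = γ then 1 else 0

end QInverse

end

/-!
The proof has three ingredients.

*Reduction.* All factors of `f` and `g` that involve `u₀`, hence also `r` and `k`, depend on the row
only or on the column only, and cancel in the matrix products (`f_eq_conj`, `g_eq_conj`). This
leaves matrices `f₀` and `g₀` depending on `q`, `t` and `u`. Since a left inverse of a
lower-triangular matrix is a right inverse (`mul_eq_comm_of_isLowerTriangular`), it suffices to show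
`g₀ * f₀ = 1`.

*Separation of variables.* Let `P_κ` be the monic polynomial with the roots `q ^ κ_s u_s`,
`1 ≤ s ≤ n`, and `q ^ (-|κ|) / t` (`nodePoly`). The ratio in the determinant of `f` is
`φ_κ(x) = P_κ(x) / (t ^ n P_κ(x / t))` at `x = q ^ β_i u_i`. Rearranging the `q`-shifted factorials
gives, for `γ ≤ κ ≤ β`,

* `f₀ κ γ = a κ * b γ * (∏ i, η_i(κ_i)) * det (x_i ^ (n - 1 - j) * (1 - t ^ j φ_γ(x_i)))`, where
  `x_i = q ^ κ_i u_i` and `η_i(b + 1) φ_γ(q ^ (b + 1) u_i) = η_i(b)` (`f₀_eq`);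
* `g₀ β κ = c β * d κ * ∏ i, θ_i(κ_i)`, where, with `x = q ^ b u_i`,
  `θ_i(b) P_β(x) = θ_i(b + 1) t ^ n P_β(q x / t)` (`g₀_eq`);
* `d κ * a κ` is a constant times `∏ i, x_i` (`g₀Col_mul_f₀Row`).

*Singularity.* As the `i`-th row of the determinant depends on `κ_i` only, the sum over `κ` is a
determinant of one-dimensional sums (`sum_Icc_det`). The polynomials `P_γ` and `P_β` are monic of
degree `n + 1` with the same constant coefficient, so `P_γ - P_β` has only the coefficients of
degrees `1, …, n`, and the vector of these annihilates the matrix: the contribution of `P_γ`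
vanishes termwise by the definition of `φ_γ`, the contribution of `P_β` telescopes
(`sum_row_eq_zero`). For `β ≠ γ` the vector is non-zero by genericity of `u`, so the determinant
vanishes (`det_sum_eq_zero`). On the diagonal, `f₀` and `g₀` have the entry `1`.
-/

noncomputable section

open Finset Polynomial

namespace QInverse

variable {K : Type*} [Field K]

/-! ### Determinants of one-dimensional sums -/

lemma sum_Icc_int_telescope (F : ℤ → K) {a b : ℤ} (h : a ≤ b) :
    ∑ x ∈ Icc a b, (F (x + 1) - F x) = F (b + 1) - F a := by
  induction b, h using Int.leInduction with
  | base => simp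
  | succ b hb ih =>
    have hIcc : Icc a (b + 1) = insert (b + 1) (Icc a b) := by
      ext x; simp only [mem_insert, mem_Icc]; omega
    rw [hIcc, sum_insert (by simp), ih]
    ring

lemma eval_eq_sum_fin {n : ℕ} {D : K[X]} (hdeg : D.natDegree < n + 1) (h0 : D.coeff 0 = 0)
    (x : K) : D.eval x = ∑ j : Fin n, D.coeff (n - j) * x ^ (n - (j : ℕ)) := by
  rw [eval_eq_sum_range' hdeg, sum_range_succ', h0, zero_mul, add_zero,
    ← sum_range_reflect, ← Fin.sum_univ_eq_sum_range
      (fun j => D.coeff (n - 1 - j + 1) * x ^ (n - 1 - j + 1))]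
  refine sum_congr rfl fun j _ => ?_
  have : n - 1 - (j : ℕ) + 1 = n - j := by omega
  rw [this]

/-- One row of the argument that the matrix of one-dimensional sums is singular: the coefficients of
`P - Q` annihilate it. The part coming from `P` vanishes termwise, the part coming from `Q`
telescopes. -/
lemma sum_row_eq_zero {n : ℕ} {t : K} {P Q : K[X]} {x η θ φ : ℤ → K} {lo hi : ℤ}
    (hle : lo ≤ hi)
    (hφ : ∀ b, lo ≤ b → b ≤ hi → φ b * (t ^ n * P.eval (x b / t)) = P.eval (x b))
    (hφlo : φ lo = 0) (hη : ∀ b, lo ≤ b → η (b + 1) * φ (b + 1) = η b)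
    (hθ : ∀ b, b < hi → θ b * Q.eval (x b) = θ (b + 1) * (t ^ n * Q.eval (x (b + 1) / t)))
    (hQ : Q.eval (x hi) = 0) :
    ∑ b ∈ Icc lo hi, η b * θ b *
      ((P - Q).eval (x b) - φ b * (t ^ n * (P - Q).eval (x b / t))) = 0 := by
  -- The cut-off at `hi` replaces the vanishing of `θ` beyond `hi`, where it is not constrained.
  set F : ℤ → K := fun b =>
    if b ≤ hi then η b * φ b * θ b * (t ^ n * Q.eval (x b / t)) else 0 with hF
  have hterm : ∀ b ∈ Icc lo hi, η b * θ b *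
      ((P - Q).eval (x b) - φ b * (t ^ n * (P - Q).eval (x b / t))) = -(F (b + 1) - F b) := by
    intro b hb
    obtain ⟨h1, h2⟩ := mem_Icc.1 hb
    have hb1 : F (b + 1) = η b * (θ b * Q.eval (x b)) := by
      rcases h2.lt_or_eq with h | rfl
      · simp only [hF]
        rw [if_pos (by omega), hθ b h, ← hη b h1]
        ring
      · simp [hF, hQ]
    rw [hb1]
    simp only [hF, if_pos h2, eval_sub]
    linear_combination (- η b * θ b) * hφ b h1 h2
  rw [sum_congr rfl hterm, sum_neg_distrib, sum_Icc_int_telescope F hle]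
  simp [hF, hφlo]

/-- The determinant of one-dimensional sums vanishes for two different monic polynomials of degree
`n + 1` with the same constant coefficient. -/
theorem det_sum_eq_zero {n : ℕ} {t : K} (ht : t ≠ 0) {P Q : K[X]}
    (hPm : P.Monic) (hQm : Q.Monic) (hPd : P.natDegree = n + 1) (hQd : Q.natDegree = n + 1)
    (h0 : P.coeff 0 = Q.coeff 0) (hPQ : P ≠ Q)
    {x η θ φ : Fin n → ℤ → K} {lo hi : Fin n → ℤ} (hle : lo ≤ hi)
    (hφ : ∀ i b, lo i ≤ b → b ≤ hi i →
      φ i b * (t ^ n * P.eval (x i b / t)) = P.eval (x i b))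
    (hφlo : ∀ i, φ i (lo i) = 0) (hη : ∀ i b, lo i ≤ b → η i (b + 1) * φ i (b + 1) = η i b)
    (hθ : ∀ i b, b < hi i →
      θ i b * Q.eval (x i b) = θ i (b + 1) * (t ^ n * Q.eval (x i (b + 1) / t)))
    (hQ : ∀ i, Q.eval (x i (hi i)) = 0) :
    Matrix.det (Matrix.of fun i j : Fin n => ∑ b ∈ Icc (lo i) (hi i),
      x i b * η i b * θ i b * (x i b ^ (n - 1 - (j : ℕ)) * (1 - t ^ (j : ℕ) * φ i b))) = 0 := by
  have hDdeg : (P - Q).natDegree < n + 1 := by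
    have h := degree_sub_lt_left (p := P) (q := Q)
      (by rw [degree_eq_natDegree hPm.ne_zero, degree_eq_natDegree hQm.ne_zero, hPd, hQd])
      hPm.ne_zero (by rw [hPm.leadingCoeff, hQm.leadingCoeff])
    rw [← hPd]
    exact natDegree_lt_natDegree (sub_ne_zero.2 hPQ) h
  have hD0 : (P - Q).coeff 0 = 0 := by simp [h0]
  -- The coefficients of `P - Q` in degrees `n, …, 1` form a non-zero vector in the kernel.
  refine Matrix.exists_mulVec_eq_zero_iff.1 ⟨fun j => (P - Q).coeff (n - j), ?_, ?_⟩
  · intro hv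
    apply sub_ne_zero.2 hPQ
    ext m
    rcases Nat.eq_zero_or_pos m with rfl | hm
    · simpa using hD0
    · rcases lt_or_ge n m with h | h
      · rw [coeff_eq_zero_of_natDegree_lt (by omega), coeff_zero]
      · have := congrFun hv ⟨n - m, by omega⟩
        simpa [Nat.sub_sub_self h] using this
  · funext i
    simp only [Matrix.mulVec, dotProduct, Matrix.of_apply, Pi.zero_apply, sum_mul]
    rw [sum_comm, ← sum_row_eq_zero (hle i) (hφ i) (hφlo i) (hη i) (hθ i) (hQ i)]
    refine sum_congr rfl fun b _ => ?_
    have hexp : t ^ n * (P - Q).eval (x i b / t)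
        = ∑ j : Fin n, (P - Q).coeff (n - j) * (t ^ (j : ℕ) * x i b ^ (n - (j : ℕ))) := by
      rw [eval_eq_sum_fin hDdeg hD0, mul_sum]
      refine sum_congr rfl fun j _ => ?_
      have h1 : t ^ n = t ^ (j : ℕ) * t ^ (n - (j : ℕ)) := by
        rw [← pow_add]; congr 1; omega
      rw [div_pow, h1]
      field_simp
    rw [hexp, eval_eq_sum_fin hDdeg hD0 (x i b), mul_sum, ← sum_sub_distrib, mul_sum]
    refine sum_congr rfl fun j _ => ?_
    have h2 : x i b ^ (n - (j : ℕ)) = x i b * x i b ^ (n - 1 - (j : ℕ)) := by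
      rw [← pow_succ']; congr 1; omega
    rw [h2]
    ring

/-- A sum over a box of determinants whose `i`-th row depends on the `i`-th index only is a
determinant of one-dimensional sums. -/
lemma sum_Icc_det {n : ℕ} (lo hi : Fin n → ℤ) (c : Fin n → ℤ → K) (M : Fin n → ℤ → Fin n → K) :
    ∑ β ∈ Icc lo hi, (∏ i, c i (β i)) * Matrix.det (Matrix.of fun i j => M i (β i) j)
      = Matrix.det (Matrix.of fun i j => ∑ b ∈ Icc (lo i) (hi i), c i b * M i b j) := by
  have h := MultilinearMap.map_sum_finset
    (Matrix.detRowAlternating (R := K) (n := Fin n)).toMultilinearMap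
    (fun i b => c i b • M i b) (fun i => Icc (lo i) (hi i))
  have h2 : (fun i => ∑ b ∈ Icc (lo i) (hi i), c i b • M i b)
      = (fun i j => ∑ b ∈ Icc (lo i) (hi i), c i b * M i b j) := by
    funext i j; simp [Finset.sum_apply]
  rw [h2] at h
  refine Eq.trans ?_ h.symm
  rw [Pi.Icc_eq]
  refine sum_congr rfl fun β _ => ?_
  exact ((Matrix.detRowAlternating (R := K) (n := Fin n)).toMultilinearMap.map_smul_univ
    (fun i => c i (β i)) (fun i => M i (β i))).symm

/-! ### The `q`-shifted factorial -/

/-- `a` is not an integral power of `q`. Then all factors of `(a;q)_m`, `m ∈ ℤ`, are non-zero. -/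
def Avoids (q a : K) : Prop := ∀ m : ℤ, a * q ^ m ≠ 1

section qPoch

variable {q a : K}

lemma Avoids.mul_zpow (hq : q ≠ 0) (ha : Avoids q a) {b : K} (k : ℤ) (h : b = a * q ^ k) :
    Avoids q b := by
  intro m
  rw [h, mul_assoc, ← zpow_add₀ hq]
  exact ha _

lemma Avoids.inv (ha : Avoids q a) {b : K} (h : b = a⁻¹) : Avoids q b := by
  intro m hm
  apply ha (-m)
  rw [← inv_inv a, ← h, zpow_neg, ← mul_inv, hm, inv_one]

lemma Avoids.one_sub_ne_zero (ha : Avoids q a) (m : ℤ) : 1 - a * q ^ m ≠ 0 :=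
  sub_ne_zero.2 (ha m).symm

lemma qPoch_zero : qPoch q a 0 = 1 := by
  change ∏ j ∈ range 0, (1 - a * q ^ j) = 1
  simp

lemma qPoch_natCast (m : ℕ) : qPoch q a m = ∏ j ∈ range m, (1 - a * q ^ j) := rfl

lemma qPoch_ne_zero (ha : Avoids q a) (m : ℤ) : qPoch q a m ≠ 0 := by
  cases m with
  | ofNat m =>
    refine prod_ne_zero_iff.2 fun j _ => ?_
    simpa using ha.one_sub_ne_zero j
  | negSucc m => exact inv_ne_zero (prod_ne_zero_iff.2 fun j _ => ha.one_sub_ne_zero _)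

lemma qPoch_succ (ha : Avoids q a) (m : ℤ) :
    qPoch q a (m + 1) = qPoch q a m * (1 - a * q ^ m) := by
  match m with
  | Int.ofNat m =>
    change ∏ j ∈ range (m + 1), (1 - a * q ^ j) = _
    rw [prod_range_succ]
    simp [qPoch]
  | Int.negSucc 0 =>
    have h := ha.one_sub_ne_zero (-1)
    change qPoch q a 0 = (∏ j ∈ range (0 + 1), (1 - a * q ^ (-((j : ℤ) + 1))))⁻¹
      * (1 - a * q ^ (-1 : ℤ))
    rw [qPoch_zero, prod_range_one]
    simp only [Nat.cast_zero, zero_add]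
    exact (inv_mul_cancel₀ h).symm
  | Int.negSucc (m + 1) =>
    have h := ha.one_sub_ne_zero (-((m + 1 : ℕ) + 1 : ℤ))
    change (∏ j ∈ range (m + 1), (1 - a * q ^ (-((j : ℤ) + 1))))⁻¹
      = (∏ j ∈ range (m + 1 + 1), (1 - a * q ^ (-((j : ℤ) + 1))))⁻¹
        * (1 - a * q ^ (-((m + 1 : ℕ) + 1 : ℤ)))
    rw [prod_range_succ _ (m + 1), mul_inv, mul_assoc, inv_mul_cancel₀ h, mul_one]

lemma qPoch_add (hq : q ≠ 0) (ha : Avoids q a) (m k : ℤ) :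
    qPoch q a (m + k) = qPoch q a m * qPoch q (a * q ^ m) k := by
  have ha' : Avoids q (a * q ^ m) := ha.mul_zpow hq m rfl
  have e (k : ℤ) : a * q ^ (m + k) = a * q ^ m * q ^ k := by rw [zpow_add₀ hq, mul_assoc]
  induction k using Int.induction_on with
  | zero => simp [qPoch_zero]
  | succ k ih => rw [← add_assoc, qPoch_succ ha, qPoch_succ ha', ih, e, mul_assoc]
  | pred k ih =>
    have h1 := qPoch_succ ha (m + (-k - 1))
    have h2 := qPoch_succ ha' (-k - 1)
    rw [show m + (-(k : ℤ) - 1) + 1 = m + -k by ring, ih] at h1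
    rw [sub_add_cancel] at h2
    rw [h2, e, ← mul_assoc] at h1
    exact (mul_right_cancel₀ (ha'.one_sub_ne_zero _) h1).symm

/-- A factorial at a shifted base point, as a quotient of factorials at the original one. -/
lemma qPoch_shift (hq : q ≠ 0) (ha : Avoids q a) (m : ℤ) {b : K} (hb : b = a * q ^ m) (k l : ℤ)
    (hl : l = m + k) : qPoch q b k = qPoch q a l / qPoch q a m := by
  rw [hb, hl, qPoch_add hq ha, mul_div_cancel_left₀ _ (qPoch_ne_zero ha m)]

end qPoch

/-! ### Telescoping products as quotients of `q`-shifted factorials -/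

section products

variable {q t X Y : K}

/-- The product of `(x - t Y) / (x - Y)` over `x = X q, …, X q ^ m`. -/
def upProd (q t X Y : K) (m : ℕ) : K :=
  ∏ c ∈ range m, (X * q ^ (c + 1) - t * Y) / (X * q ^ (c + 1) - Y)

/-- The product of `(q x - t Y) / (x - Y)` over `x = X / q, …, X / q ^ m`. -/
def downProd (q t X Y : K) (m : ℕ) : K :=
  ∏ c ∈ range m, (X * (q ^ c)⁻¹ - t * Y) / (X * (q ^ (c + 1))⁻¹ - Y)

lemma upProd_eq (ht : t ≠ 0) (hY : Y ≠ 0) (m : ℕ) :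
    upProd q t X Y m = t ^ m * (qPoch q (q * X / (t * Y)) m / qPoch q (q * X / Y) m) := by
  rw [qPoch_natCast, qPoch_natCast, ← prod_div_distrib, upProd, ← card_range m, ← prod_const,
    card_range, ← prod_mul_distrib]
  refine prod_congr rfl fun c _ => ?_
  have h1 : X * q ^ (c + 1) - t * Y = -Y * (t * (1 - q * X / (t * Y) * q ^ c)) := by
    field_simp; ring
  have h2 : X * q ^ (c + 1) - Y = -Y * (1 - q * X / Y * q ^ c) := by
    field_simp; ring
  rw [h1, h2, mul_div_mul_left _ _ (neg_ne_zero.2 hY), mul_div_assoc]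

/-- The product of `upProd_eq` read from its last factor to its first. -/
lemma upProd_eq' (hq : q ≠ 0) (hX : X ≠ 0) (m : ℕ) :
    upProd q t X Y m = qPoch q ((q ^ m)⁻¹ * (t * Y / X)) m / qPoch q ((q ^ m)⁻¹ * (Y / X)) m := by
  rw [qPoch_natCast, qPoch_natCast, ← prod_div_distrib, upProd, ← prod_range_reflect]
  refine prod_congr rfl fun c hc => ?_
  have hc' : m - 1 - c + 1 + c = m := by have := mem_range.1 hc; omega
  have hp : q ^ m = q ^ (m - 1 - c + 1) * q ^ c := by rw [← pow_add, hc']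
  rw [hp]
  set e := m - 1 - c + 1
  have h1 : X * q ^ e - t * Y = (X * q ^ e) * (1 - (q ^ e * q ^ c)⁻¹ * (t * Y / X) * q ^ c) := by
    field_simp
  have h2 : X * q ^ e - Y = (X * q ^ e) * (1 - (q ^ e * q ^ c)⁻¹ * (Y / X) * q ^ c) := by
    field_simp
  rw [h1, h2, mul_div_mul_left _ _ (by positivity)]

lemma downProd_eq (hq : q ≠ 0) (hX : X ≠ 0) (m : ℕ) :
    downProd q t X Y m = q ^ m * (qPoch q (t * Y / X) m / qPoch q (q * Y / X) m) := by
  rw [qPoch_natCast, qPoch_natCast, ← prod_div_distrib, downProd, ← card_range m, ← prod_const,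
    card_range, ← prod_mul_distrib]
  refine prod_congr rfl fun c _ => ?_
  have h1 : X * (q ^ c)⁻¹ - t * Y = (X * (q ^ (c + 1))⁻¹) * (q * (1 - t * Y / X * q ^ c)) := by
    field_simp; ring
  have h2 : X * (q ^ (c + 1))⁻¹ - Y = (X * (q ^ (c + 1))⁻¹) * (1 - q * Y / X * q ^ c) := by
    field_simp; ring
  rw [h1, h2, mul_div_mul_left _ _ (by positivity), mul_div_assoc]

/-- The product of `downProd_eq` read from its last factor to its first. -/
lemma downProd_eq' (hq : q ≠ 0) (ht : t ≠ 0) (hY : Y ≠ 0) (m : ℕ) :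
    downProd q t X Y m = t ^ m *
      (qPoch q (q * (q ^ m)⁻¹ * X / (t * Y)) m / qPoch q ((q ^ m)⁻¹ * X / Y) m) := by
  rw [qPoch_natCast, qPoch_natCast, ← prod_div_distrib, downProd, ← card_range m, ← prod_const,
    card_range, ← prod_mul_distrib, ← prod_range_reflect]
  refine prod_congr rfl fun c hc => ?_
  have := mem_range.1 hc
  have hp : q ^ m = q * (q ^ (m - 1 - c) * q ^ c) := by
    rw [← pow_add, ← pow_succ']; congr 1; omega
  rw [hp, pow_succ]
  set e := m - 1 - c
  have h1 : X * (q ^ e)⁻¹ - t * Y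
      = -Y * (t * (1 - q * (q * (q ^ e * q ^ c))⁻¹ * X / (t * Y) * q ^ c)) := by
    field_simp; ring
  have h2 : X * (q ^ e * q)⁻¹ - Y
      = -Y * (1 - (q * (q ^ e * q ^ c))⁻¹ * X / Y * q ^ c) := by
    field_simp; ring
  rw [h1, h2, mul_div_mul_left _ _ (neg_ne_zero.2 hY), mul_div_assoc]

/-- The quotient `(qz;q)_m / (qz/t;q)_m`, the dependence of a pair factor of `f` on its row. -/
def rho (q t z : K) (m : ℤ) : K := qPoch q (q * z) m / qPoch q (q * z / t) m

/-- The quotient `(z;q)_m / (qz/t;q)_m`, the dependence of a pair factor of `g` on its row. -/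
def sigma (q t z : K) (m : ℤ) : K := qPoch q z m / qPoch q (q * z / t) m

/-- The factor of `f` for a pair `i < j` is, up to factors depending only on the row or only on the
column, a product over both orderings of the pair. -/
lemma f_pair (hq : q ≠ 0) (ht : t ≠ 0) {a c : K} (ha : a ≠ 0) (hc : c ≠ 0)
    (hz : Avoids q (a / c)) (hzt : Avoids q (a / (t * c)))
    {bi bj ki kj : ℤ} {mi mj : ℕ} (hi : bi = ki + mi) (hj : bj = kj + mj) :
    (qPoch q (q ^ (bi - bj + 1) * a / (t * c)) mj / qPoch q (q ^ (bi - bj + 1) * a / c) mj)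
      * (qPoch q (q ^ (ki - bj) * t * a / c) mj / qPoch q (q ^ (ki - bj) * a / c) mj)
    = (t ^ (bi - ki))⁻¹ * (rho q t (a / c) (bi - bj) / rho q t (a / c) (ki - kj))
      * (upProd q t (q ^ ki * a) (q ^ kj * c) mi * upProd q t (q ^ kj * c) (q ^ ki * a) mj) := by
  have hz1 : Avoids q (q * (a / c)) := hz.mul_zpow hq 1 (by rw [zpow_one, mul_comm])
  have hzt1 : Avoids q (q * (a / c) / t) := hzt.mul_zpow hq 1 (by rw [zpow_one]; field_simp)
  rw [upProd_eq ht (by positivity), upProd_eq' hq (by positivity), rho, rho]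
  have e1 : (q ^ mj)⁻¹ * (t * (q ^ ki * a) / (q ^ kj * c)) = q ^ (ki - bj) * t * a / c := by
    rw [hj, zpow_sub₀ hq, zpow_add₀ hq, zpow_natCast]; field_simp
  have e2 : (q ^ mj)⁻¹ * ((q ^ ki * a) / (q ^ kj * c)) = q ^ (ki - bj) * a / c := by
    rw [hj, zpow_sub₀ hq, zpow_add₀ hq, zpow_natCast]; field_simp
  rw [e1, e2]
  rw [qPoch_shift hq hzt1 (bi - bj) (b := q ^ (bi - bj + 1) * a / (t * c))
      (by rw [zpow_add₀ hq, zpow_one]; field_simp) mj (bi - kj) (by omega),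
    qPoch_shift hq hz1 (bi - bj) (b := q ^ (bi - bj + 1) * a / c)
      (by rw [zpow_add₀ hq, zpow_one]; field_simp) mj (bi - kj) (by omega),
    qPoch_shift hq hzt1 (ki - kj) (b := q * (q ^ ki * a) / (t * (q ^ kj * c)))
      (by rw [zpow_sub₀ hq]; field_simp) mi (bi - kj) (by omega),
    qPoch_shift hq hz1 (ki - kj) (b := q * (q ^ ki * a) / (q ^ kj * c))
      (by rw [zpow_sub₀ hq]; field_simp) mi (bi - kj) (by omega)]
  have n1 := qPoch_ne_zero hz1
  have n2 := qPoch_ne_zero hzt1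
  have e3 : t ^ (bi - ki) = t ^ mi := by rw [hi, add_sub_cancel_left, zpow_natCast]
  rw [e3]
  generalize qPoch q (q ^ (ki - bj) * t * a / c) mj / qPoch q (q ^ (ki - bj) * a / c) mj = W
  have m1 := n1 (bi - bj)
  have m2 := n1 (bi - kj)
  have m3 := n1 (ki - kj)
  have m4 := n2 (bi - bj)
  have m5 := n2 (bi - kj)
  have m6 := n2 (ki - kj)
  generalize qPoch q (q * (a / c)) = A at *
  generalize qPoch q (q * (a / c) / t) = B at *
  field_simp

/-- The factor of `g` for a pair `i < j`, in the same form. -/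
lemma g_pair (hq : q ≠ 0) (ht : t ≠ 0) {a c : K} (ha : a ≠ 0) (hc : c ≠ 0)
    (hz : Avoids q (a / c)) (hzt : Avoids q (a / (t * c)))
    {ki kj gi gj : ℤ} {mi mj : ℕ} (hi : ki = gi + mi) (hj : kj = gj + mj) :
    (qPoch q (q ^ (ki - kj) * t * a / c) mj / qPoch q (q ^ (ki - kj + 1) * a / c) mj)
      * (qPoch q (q ^ (gi - kj + 1) * a / (t * c)) mj / qPoch q (q ^ (gi - kj) * a / c) mj)
    = (t ^ (ki - gi) * q ^ (kj - gj))⁻¹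
      * (sigma q t (a / c) (ki - kj) / sigma q t (a / c) (gi - gj))
      * (downProd q t (q ^ ki * a) (q ^ kj * c) mi
        * downProd q t (q ^ kj * c) (q ^ ki * a) mj) := by
  have hzt1 : Avoids q (q * (a / c) / t) := hzt.mul_zpow hq 1 (by rw [zpow_one]; field_simp)
  rw [downProd_eq' hq ht (by positivity), downProd_eq hq (by positivity), sigma, sigma]
  have e1 : t * (q ^ ki * a) / (q ^ kj * c) = q ^ (ki - kj) * t * a / c := by
    rw [zpow_sub₀ hq]; field_simp
  have e2 : q * (q ^ ki * a) / (q ^ kj * c) = q ^ (ki - kj + 1) * a / c := by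
    rw [zpow_add₀ hq, zpow_sub₀ hq, zpow_one]; field_simp
  rw [e1, e2]
  rw [qPoch_shift hq hzt1 (gi - kj) (b := q ^ (gi - kj + 1) * a / (t * c))
      (by rw [zpow_add₀ hq, zpow_one]; field_simp) mj (gi - gj) (by omega),
    qPoch_shift hq hz (gi - kj) (b := q ^ (gi - kj) * a / c)
      (by field_simp) mj (gi - gj) (by omega),
    qPoch_shift hq hzt1 (gi - kj) (b := q * (q ^ mi)⁻¹ * (q ^ ki * a) / (t * (q ^ kj * c)))
      (by rw [hi, zpow_sub₀ hq, zpow_add₀ hq, zpow_natCast]; field_simp) mi (ki - kj) (by omega),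
    qPoch_shift hq hz (gi - kj) (b := (q ^ mi)⁻¹ * (q ^ ki * a) / (q ^ kj * c))
      (by rw [hi, zpow_sub₀ hq, zpow_add₀ hq, zpow_natCast]; field_simp) mi (ki - kj) (by omega)]
  have n1 := qPoch_ne_zero hz
  have n2 := qPoch_ne_zero hzt1
  have e3 : t ^ (ki - gi) = t ^ mi := by rw [hi, add_sub_cancel_left, zpow_natCast]
  have e4 : q ^ (kj - gj) = q ^ mj := by rw [hj, add_sub_cancel_left, zpow_natCast]
  rw [e3, e4]
  generalize hW : qPoch q (q ^ (ki - kj) * t * a / c) mj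
    / qPoch q (q ^ (ki - kj + 1) * a / c) mj = W
  have m1 := n1 (gi - gj)
  have m2 := n1 (gi - kj)
  have m3 := n1 (ki - kj)
  have m4 := n2 (gi - gj)
  have m5 := n2 (gi - kj)
  have m6 := n2 (ki - kj)
  generalize qPoch q (a / c) = A at *
  generalize qPoch q (q * (a / c) / t) = B at *
  field_simp

lemma rho_div_sigma (hq : q ≠ 0) {z : K} (hz : Avoids q z) (hzt : Avoids q (z / t)) (m : ℤ) :
    rho q t z m / sigma q t z m = (1 - z * q ^ m) / (1 - z) := by
  have hzt1 : Avoids q (q * z / t) := hzt.mul_zpow hq 1 (by rw [zpow_one]; ring)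
  have h0 : 1 - z ≠ 0 := by simpa using hz.one_sub_ne_zero 0
  have h1 := qPoch_add hq hz 1 m
  rw [add_comm 1 m, qPoch_succ hz, zpow_one, mul_comm z q] at h1
  have h2 : qPoch q z 1 = 1 - z := by
    have := qPoch_succ hz 0
    simpa [qPoch_zero] using this
  rw [h2] at h1
  have := qPoch_ne_zero hz m
  have := qPoch_ne_zero hzt1 m
  rw [rho, sigma, div_div_div_cancel_right₀ (by assumption), div_eq_div_iff (by assumption) h0]
  linear_combination -h1

end products

/-! ### Separation of variables in the two matrices -/

/-- The genericity of the parameters `t, u₁, …, uₙ` used in the inversion. -/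
structure Generic {n : ℕ} (q t : K) (u : Fin n → K) : Prop where
  q_ne_zero : q ≠ 0
  t_ne_zero : t ≠ 0
  u_ne_zero : ∀ i, u i ≠ 0
  zpow_ne_one : ∀ m : ℤ, m ≠ 0 → q ^ m ≠ 1
  t_avoids : Avoids q t
  u_avoids : ∀ i, Avoids q (u i)
  t_mul_u_avoids : ∀ i, Avoids q (t * u i)
  u_div_avoids : ∀ i j, i ≠ j → Avoids q (u i / u j)
  t_mul_u_div_avoids : ∀ i j, i ≠ j → Avoids q (t * u i / u j)

section

variable {n : ℕ} (q t : K) (u : Fin n → K)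

/-- The matrix `f` without the factors that depend on its row only or on its column only and that
involve `u₀`. -/
def f₀ (β κ : Fin n → ℤ) : K :=
  q ^ (size β - size κ)
  * (∏ i : Fin n,
      (qPoch q (q / t) (β i - κ i) * qPochSelfRecip q (β i - κ i))
      * (qPoch q (q ^ (κ i + size κ + 1) * u i) (β i - κ i)
          / qPoch q (q ^ (κ i + size κ + 1) * t * u i) (β i - κ i)))
  * (∏ i : Fin n, ∏ j ∈ Finset.Ioi i,
      (qPoch q (q ^ (β i - β j + 1) * u i / (t * u j)) (β j - κ j)
          / qPoch q (q ^ (β i - β j + 1) * u i / u j) (β j - κ j))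
      * (qPoch q (q ^ (κ i - β j) * t * u i / u j) (β j - κ j)
          / qPoch q (q ^ (κ i - β j) * u i / u j) (β j - κ j))
      * (q ^ β i * u i - q ^ β j * u j)⁻¹)
  * Matrix.det (Matrix.of fun i j : Fin n =>
      (q ^ β i * u i) ^ (n - 1 - (j : ℕ))
      * (1 - t ^ (j : ℕ)
          * ((1 - q ^ (β i + size κ) * t * u i) / (1 - q ^ (β i + size κ) * u i))
          * ∏ s : Fin n, (q ^ β i * u i - q ^ κ s * u s) / (q ^ β i * u i - q ^ κ s * t * u s)))

/-- The matrix `g` without the factors that depend on its row only or on its column only and that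
involve `u₀`. -/
def g₀ (κ γ : Fin n → ℤ) : K :=
  (q / t) ^ (size κ - size γ)
  * (∏ i : Fin n,
      (qPoch q t (κ i - γ i) * qPochSelfRecip q (κ i - γ i))
      * (qPoch q (q ^ (γ i + size κ + 1) * u i) (κ i - γ i)
          / qPoch q (q ^ (γ i + size κ) * t * u i) (κ i - γ i)))
  * (∏ i : Fin n, ∏ j ∈ Finset.Ioi i,
      (qPoch q (q ^ (κ i - κ j) * t * u i / u j) (κ j - γ j)
          / qPoch q (q ^ (κ i - κ j + 1) * u i / u j) (κ j - γ j))
      * (qPoch q (q ^ (γ i - κ j + 1) * u i / (t * u j)) (κ j - γ j)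
          / qPoch q (q ^ (γ i - κ j) * u i / u j) (κ j - γ j)))

/-- The factors of `f` that depend on its row only and involve `u₀`. -/
def rowFactor (u₀ : K) (k : ℕ) (β : Fin n → ℤ) : K :=
  (qPoch q (t ^ 2 * u₀) (size β) / qPoch q (q * t * u₀) (size β))
  * (∏ i ∈ Finset.univ.filter (fun i : Fin n => (i : ℕ) + 1 < k),
      (qPoch q (u i / (t * u₀)) (β i) / qPoch q (q * u i / (t ^ 2 * u₀)) (β i)))
  * (∏ i ∈ Finset.univ.filter (fun i : Fin n => k ≤ (i : ℕ) + 1),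
      (qPoch q (t * u i / u₀) (β i) / qPoch q (q * u i / u₀) (β i)))

/-- The factors of `f` that depend on its column only and involve `u₀`. -/
def colFactor (u₀ : K) (r k : ℕ) (κ : Fin n → ℤ) : K :=
  (qPoch q (q * t * u₀) (size κ) / qPoch q (t ^ 2 * u₀) (size κ))
  * (∏ i ∈ Finset.univ.filter (fun i : Fin n => (i : ℕ) + 1 < k),
      (qPoch q (q * u i / (t * u₀)) (κ i) / qPoch q (u i / u₀) (κ i))
      * (qPoch q (u i / u₀) (size κ - r + κ i)
          / qPoch q (q * u i / (t * u₀)) (size κ - r + κ i))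
      * (qPoch q (q * u i / (t ^ 2 * u₀)) (size κ - r + κ i)
          / qPoch q (u i / (t * u₀)) (size κ - r + κ i)))
  * (∏ i ∈ Finset.univ.filter (fun i : Fin n => k ≤ (i : ℕ) + 1),
      (qPoch q (q * u i / u₀) (κ i) / qPoch q (t * u i / u₀) (κ i)))

lemma f_eq_conj (u₀ : K) (r k : ℕ) (β κ : Fin n → ℤ) :
    f q t u₀ u r k β κ = rowFactor q t u u₀ k β * colFactor q t u u₀ r k κ * f₀ q t u β κ := by
  simp only [f, f₀, rowFactor, colFactor, prod_mul_distrib]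
  ring

lemma g_eq_conj (u₀ : K) (r k : ℕ) (κ γ : Fin n → ℤ) :
    g q t u₀ u r k κ γ
      = (colFactor q t u u₀ r k κ)⁻¹ * (rowFactor q t u u₀ k γ)⁻¹ * g₀ q t u κ γ := by
  simp only [g, g₀, rowFactor, colFactor, div_eq_mul_inv, mul_inv, inv_inv, prod_mul_distrib,
    ← prod_inv_distrib]
  ring

/-- The ratio `φ_κ(x) = P_κ(x) / (t ^ n P_κ(x / t))` at `x = q ^ b u_i`, as it occurs in the
determinant; for `P_κ` see `nodePoly`. -/
def phi (κ : Fin n → ℤ) (i : Fin n) (b : ℤ) : K :=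
  (1 - q ^ (b + size κ) * t * u i) / (1 - q ^ (b + size κ) * u i)
    * ∏ s : Fin n, (q ^ b * u i - q ^ κ s * u s) / (q ^ b * u i - q ^ κ s * t * u s)

/-- The ratio `t ^ n P_κ(q x / t) / P_κ(x)` at `x = q ^ b u_i`. -/
def psi (κ : Fin n → ℤ) (i : Fin n) (b : ℤ) : K :=
  (1 - q ^ (b + 1 + size κ) * u i) / (1 - q ^ (b + size κ) * t * u i)
    * ∏ s : Fin n, (q ^ (b + 1) * u i - q ^ κ s * t * u s) / (q ^ b * u i - q ^ κ s * u s)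

/-- The value at `b = κ_i + m` of the solution of `η (b + 1) * φ_κ (q ^ (b + 1) u_i) = η b`,
`b ≥ κ_i`, with value `1` at `b = κ_i`. -/
def eta (κ : Fin n → ℤ) (i : Fin n) (m : ℕ) : K :=
  ∏ c ∈ range m, (phi q t u κ i (κ i + (c + 1)))⁻¹

/-- The value at `b = κ_i - m` of the solution of `θ b = θ (b + 1) * ψ_κ (q ^ b u_i)`, `b < κ_i`,
with value `1` at `b = κ_i`; here `ψ_κ` is the ratio `psi`. -/
def theta (κ : Fin n → ℤ) (i : Fin n) (m : ℕ) : K :=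
  ∏ c ∈ range m, psi q t u κ i (κ i - (c + 1))

lemma prod_prod_eq_diag_mul (F : Fin n → Fin n → K) :
    ∏ i, ∏ s, F i s = (∏ i, F i i) * ∏ i, ∏ j ∈ Ioi i, F i j * F j i := by
  have h := prod_prod_Ioi_mul_eq_prod_prod_off_diag fun i j => F j i
  rw [h, ← prod_mul_distrib]
  refine prod_congr rfl fun i _ => ?_
  rw [Fintype.prod_eq_mul_prod_compl i]

variable {q t u}

lemma eta_eq (hq : q ≠ 0) (κ : Fin n → ℤ) (i : Fin n) (m : ℕ) :
    eta q t u κ i m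
      = (qPoch q (q ^ (κ i + size κ + 1) * u i) m
          / qPoch q (q ^ (κ i + size κ + 1) * t * u i) m)
        * ∏ s, upProd q t (q ^ κ i * u i) (q ^ κ s * u s) m := by
  simp only [eta, phi, upProd, qPoch_natCast]
  rw [prod_comm, ← prod_div_distrib, ← prod_mul_distrib]
  refine prod_congr rfl fun c _ => ?_
  rw [mul_inv, inv_div, ← prod_inv_distrib]
  congr 1
  · have : q ^ (κ i + (↑c + 1) + size κ) = q ^ (κ i + size κ + 1) * q ^ c := by
      rw [← zpow_natCast, ← zpow_add₀ hq]; congr 1; ring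
    rw [this]; ring
  · refine prod_congr rfl fun s _ => ?_
    have : q ^ (κ i + ((c : ℤ) + 1)) = q ^ κ i * q ^ (c + 1) := by
      rw [← zpow_natCast, ← zpow_add₀ hq]; push_cast; rfl
    rw [this, inv_div]
    congr 1 <;> ring

lemma theta_eq (hq : q ≠ 0) (κ : Fin n → ℤ) (i : Fin n) (m : ℕ) {g : ℤ} (hg : κ i = g + m) :
    theta q t u κ i m
      = (qPoch q (q ^ (g + size κ + 1) * u i) m / qPoch q (q ^ (g + size κ) * t * u i) m)
        * ∏ s, downProd q t (q ^ κ i * u i) (q ^ κ s * u s) m := by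
  simp only [theta, psi, downProd, qPoch_natCast, prod_mul_distrib]
  rw [prod_comm]
  congr 1
  · rw [← prod_div_distrib, ← prod_range_reflect]
    refine prod_congr rfl fun c hc => ?_
    have hc := mem_range.1 hc
    have h1 : q ^ (κ i - ((m - 1 - c : ℕ) + 1) + 1 + size κ) = q ^ (g + size κ + 1) * q ^ c := by
      rw [← zpow_natCast, ← zpow_add₀ hq]; congr 1; omega
    have h2 : q ^ (κ i - ((m - 1 - c : ℕ) + 1) + size κ) = q ^ (g + size κ) * q ^ c := by
      rw [← zpow_natCast, ← zpow_add₀ hq]; congr 1; omega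
    rw [h1, h2]
    congr 1 <;> ring
  · refine prod_congr rfl fun s _ => prod_congr rfl fun c _ => ?_
    have h1 : q ^ (κ i - ((c : ℤ) + 1) + 1) = q ^ κ i * (q ^ c)⁻¹ := by
      rw [← zpow_natCast, ← zpow_neg, ← zpow_add₀ hq]; congr 1; ring
    have h2 : q ^ (κ i - ((c : ℤ) + 1)) = q ^ κ i * (q ^ (c + 1))⁻¹ := by
      rw [← zpow_natCast, ← zpow_neg, ← zpow_add₀ hq]; push_cast; rfl
    rw [h1, h2]
    congr 1 <;> ring

lemma qPochSelfRecip_natCast (m : ℕ) : qPochSelfRecip q m = (qPoch q q m)⁻¹ := by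
  simp [qPochSelfRecip]

lemma zpow_size (hx : q ≠ 0) (κ : Fin n → ℤ) : q ^ size κ = ∏ i, q ^ κ i := by
  rw [size]
  induction (univ : Finset (Fin n)) using Finset.cons_induction with
  | empty => simp
  | cons a s ha ih => rw [sum_cons, prod_cons, zpow_add₀ hx, ih]

lemma Generic.u_div_t_avoids (h : Generic q t u) {i j : Fin n} (hij : i ≠ j) :
    Avoids q (u i / (t * u j)) :=
  (h.t_mul_u_div_avoids j i hij.symm).inv (by rw [inv_div])

variable (q t u) in
/-- The dependence of `f₀` on its row, apart from `eta` and the determinant. -/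
def f₀Row (β : Fin n → ℤ) : K :=
  (∏ i, (q / t) ^ β i) * ∏ i, ∏ j ∈ Ioi i,
    (t ^ β i)⁻¹ * rho q t (u i / u j) (β i - β j) * (q ^ β i * u i - q ^ β j * u j)⁻¹

variable (q t u) in
/-- The dependence of `f₀` on its column, apart from `eta` and the determinant. -/
def f₀Col (κ : Fin n → ℤ) : K :=
  (∏ i, (q / t) ^ κ i)⁻¹ * ∏ i, ∏ j ∈ Ioi i, t ^ κ i * (rho q t (u i / u j) (κ i - κ j))⁻¹

variable (q t u) in
/-- The dependence of `g₀` on its row, apart from `theta`. -/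
def g₀Row (κ : Fin n → ℤ) : K :=
  (∏ i, (t ^ κ i)⁻¹) * ∏ i, ∏ j ∈ Ioi i,
    (t ^ κ i)⁻¹ * (q ^ κ j)⁻¹ * sigma q t (u i / u j) (κ i - κ j)

variable (q t u) in
/-- The dependence of `g₀` on its column, apart from `theta`. -/
def g₀Col (γ : Fin n → ℤ) : K :=
  (∏ i, t ^ γ i) * ∏ i, ∏ j ∈ Ioi i,
    t ^ γ i * q ^ γ j * (sigma q t (u i / u j) (γ i - γ j))⁻¹

lemma f_diag (ht : t ≠ 0) {x : K} (hx : x ≠ 0) (m : ℕ) :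
    qPoch q (q / t) m * qPochSelfRecip q m = (t ^ m)⁻¹ * upProd q t x x m := by
  rw [upProd_eq ht hx, qPochSelfRecip_natCast, mul_div_mul_right _ _ hx, mul_div_cancel_right₀ _ hx,
    inv_mul_cancel_left₀ (pow_ne_zero _ ht), div_eq_mul_inv (qPoch _ _ _)]

lemma g_diag (hq : q ≠ 0) {x : K} (hx : x ≠ 0) (m : ℕ) :
    qPoch q t m * qPochSelfRecip q m = (q ^ m)⁻¹ * downProd q t x x m := by
  rw [downProd_eq hq hx, qPochSelfRecip_natCast, mul_div_cancel_right₀ _ hx,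
    mul_div_cancel_right₀ _ hx, inv_mul_cancel_left₀ (pow_ne_zero _ hq),
    div_eq_mul_inv (qPoch _ _ _)]

lemma f₀_eq (h : Generic q t u) {β κ : Fin n → ℤ} (hle : κ ≤ β) :
    f₀ q t u β κ = f₀Row q t u β * f₀Col q t u κ * (∏ i, eta q t u κ i (β i - κ i).toNat)
      * Matrix.det (Matrix.of fun i j : Fin n =>
        (q ^ β i * u i) ^ (n - 1 - (j : ℕ)) * (1 - t ^ (j : ℕ) * phi q t u κ i (β i))) := by
  have hq := h.q_ne_zero
  have ht := h.t_ne_zero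
  have hm : ∀ i, ∃ m : ℕ, β i = κ i + m := fun i => Int.le.dest (hle i) |>.imp fun _ h => h.symm
  choose m hm using hm
  have hd (i) : β i - κ i = m i := by rw [hm]; ring
  have hdiag : ∏ i : Fin n,
      (qPoch q (q / t) (β i - κ i) * qPochSelfRecip q (β i - κ i))
      * (qPoch q (q ^ (κ i + size κ + 1) * u i) (β i - κ i)
          / qPoch q (q ^ (κ i + size κ + 1) * t * u i) (β i - κ i))
      = ∏ i : Fin n, ((t ^ m i)⁻¹ * upProd q t (q ^ κ i * u i) (q ^ κ i * u i) (m i))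
      * (qPoch q (q ^ (κ i + size κ + 1) * u i) (m i)
          / qPoch q (q ^ (κ i + size κ + 1) * t * u i) (m i)) := by
    refine prod_congr rfl fun i _ => ?_
    rw [hd, f_diag ht (mul_ne_zero (zpow_ne_zero (κ i) hq) (h.u_ne_zero i))]
  have hpair : ∏ i : Fin n, ∏ j ∈ Finset.Ioi i,
      (qPoch q (q ^ (β i - β j + 1) * u i / (t * u j)) (β j - κ j)
          / qPoch q (q ^ (β i - β j + 1) * u i / u j) (β j - κ j))
      * (qPoch q (q ^ (κ i - β j) * t * u i / u j) (β j - κ j)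
          / qPoch q (q ^ (κ i - β j) * u i / u j) (β j - κ j))
      * (q ^ β i * u i - q ^ β j * u j)⁻¹
      = ∏ i : Fin n, ∏ j ∈ Finset.Ioi i,
        ((t ^ β i)⁻¹ * rho q t (u i / u j) (β i - β j) * (q ^ β i * u i - q ^ β j * u j)⁻¹)
        * (t ^ κ i * (rho q t (u i / u j) (κ i - κ j))⁻¹)
        * (upProd q t (q ^ κ i * u i) (q ^ κ j * u j) (m i)
          * upProd q t (q ^ κ j * u j) (q ^ κ i * u i) (m j)) := by
    refine prod_congr rfl fun i _ => prod_congr rfl fun j hj => ?_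
    have hij : i ≠ j := (mem_Ioi.1 hj).ne
    rw [hd, f_pair hq ht (h.u_ne_zero i) (h.u_ne_zero j) (h.u_div_avoids i j hij)
      (h.u_div_t_avoids hij) (hm i) (hm j), zpow_sub₀ ht, inv_div, div_eq_mul_inv, div_eq_mul_inv]
    ring
  have hpow : q ^ (size β - size κ) * ∏ i, (t ^ m i)⁻¹
      = (∏ i, (q / t) ^ β i) * (∏ i, (q / t) ^ κ i)⁻¹ := by
    rw [zpow_sub₀ hq, zpow_size hq, zpow_size hq, ← prod_div_distrib, ← prod_inv_distrib,
      ← prod_mul_distrib, ← prod_mul_distrib]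
    refine prod_congr rfl fun i _ => ?_
    rw [← zpow_natCast t, ← hd, zpow_sub₀ ht, div_zpow, div_zpow]
    field_simp
  have heta : ∏ i, eta q t u κ i (β i - κ i).toNat
      = (∏ i, (qPoch q (q ^ (κ i + size κ + 1) * u i) (m i)
          / qPoch q (q ^ (κ i + size κ + 1) * t * u i) (m i))) *
      ((∏ i, upProd q t (q ^ κ i * u i) (q ^ κ i * u i) (m i)) *
        ∏ i, ∏ j ∈ Ioi i, upProd q t (q ^ κ i * u i) (q ^ κ j * u j) (m i)
          * upProd q t (q ^ κ j * u j) (q ^ κ i * u i) (m j)) := by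
    rw [← prod_prod_eq_diag_mul fun i j => upProd q t (q ^ κ i * u i) (q ^ κ j * u j) (m i),
      ← prod_mul_distrib]
    refine prod_congr rfl fun i _ => ?_
    rw [hd, Int.toNat_natCast, eta_eq hq]
  have hdet : (Matrix.of fun i j : Fin n =>
      (q ^ β i * u i) ^ (n - 1 - (j : ℕ))
      * (1 - t ^ (j : ℕ)
          * ((1 - q ^ (β i + size κ) * t * u i) / (1 - q ^ (β i + size κ) * u i))
          * ∏ s : Fin n, (q ^ β i * u i - q ^ κ s * u s) / (q ^ β i * u i - q ^ κ s * t * u s)))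
      = Matrix.of fun i j : Fin n =>
        (q ^ β i * u i) ^ (n - 1 - (j : ℕ)) * (1 - t ^ (j : ℕ) * phi q t u κ i (β i)) := by
    ext i j
    simp only [Matrix.of_apply, phi, mul_assoc]
  rw [f₀, hdiag, hpair, hdet, heta, f₀Row, f₀Col]
  simp only [prod_mul_distrib] at hpow ⊢
  linear_combination (∏ i, upProd q t (q ^ κ i * u i) (q ^ κ i * u i) (m i))
      * (∏ i, (qPoch q (q ^ (κ i + size κ + 1) * u i) (m i)
          / qPoch q (q ^ (κ i + size κ + 1) * t * u i) (m i)))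
      * ((∏ i : Fin n, ∏ j ∈ Finset.Ioi i, (t ^ β i)⁻¹)
        * (∏ i : Fin n, ∏ j ∈ Finset.Ioi i, rho q t (u i / u j) (β i - β j))
        * (∏ i : Fin n, ∏ j ∈ Finset.Ioi i, (q ^ β i * u i - q ^ β j * u j)⁻¹)
        * ((∏ i : Fin n, ∏ j ∈ Finset.Ioi i, t ^ κ i)
          * (∏ i : Fin n, ∏ j ∈ Finset.Ioi i, (rho q t (u i / u j) (κ i - κ j))⁻¹))
        * ((∏ i : Fin n, ∏ j ∈ Finset.Ioi i, upProd q t (q ^ κ i * u i) (q ^ κ j * u j) (m i))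
          * (∏ i : Fin n, ∏ j ∈ Finset.Ioi i, upProd q t (q ^ κ j * u j) (q ^ κ i * u i) (m j))))
      * (Matrix.of fun i j : Fin n =>
        (q ^ β i * u i) ^ (n - 1 - (j : ℕ)) * (1 - t ^ (j : ℕ) * phi q t u κ i (β i))).det * hpow

lemma g₀_eq (h : Generic q t u) {κ γ : Fin n → ℤ} (hle : γ ≤ κ) :
    g₀ q t u κ γ = g₀Row q t u κ * g₀Col q t u γ * ∏ i, theta q t u κ i (κ i - γ i).toNat := by
  have hq := h.q_ne_zero
  have ht := h.t_ne_zero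
  have hm : ∀ i, ∃ m : ℕ, κ i = γ i + m := fun i => Int.le.dest (hle i) |>.imp fun _ h => h.symm
  choose m hm using hm
  have hd (i) : κ i - γ i = m i := by rw [hm]; ring
  have hdiag : ∏ i : Fin n,
      (qPoch q t (κ i - γ i) * qPochSelfRecip q (κ i - γ i))
      * (qPoch q (q ^ (γ i + size κ + 1) * u i) (κ i - γ i)
          / qPoch q (q ^ (γ i + size κ) * t * u i) (κ i - γ i))
      = ∏ i : Fin n, ((q ^ m i)⁻¹ * downProd q t (q ^ κ i * u i) (q ^ κ i * u i) (m i))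
      * (qPoch q (q ^ (γ i + size κ + 1) * u i) (m i)
          / qPoch q (q ^ (γ i + size κ) * t * u i) (m i)) := by
    refine prod_congr rfl fun i _ => ?_
    rw [hd, g_diag hq (mul_ne_zero (zpow_ne_zero (κ i) hq) (h.u_ne_zero i))]
  have hpair : ∏ i : Fin n, ∏ j ∈ Finset.Ioi i,
      (qPoch q (q ^ (κ i - κ j) * t * u i / u j) (κ j - γ j)
          / qPoch q (q ^ (κ i - κ j + 1) * u i / u j) (κ j - γ j))
      * (qPoch q (q ^ (γ i - κ j + 1) * u i / (t * u j)) (κ j - γ j)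
          / qPoch q (q ^ (γ i - κ j) * u i / u j) (κ j - γ j))
      = ∏ i : Fin n, ∏ j ∈ Finset.Ioi i,
        ((t ^ κ i)⁻¹ * (q ^ κ j)⁻¹ * sigma q t (u i / u j) (κ i - κ j))
        * (t ^ γ i * q ^ γ j * (sigma q t (u i / u j) (γ i - γ j))⁻¹)
        * (downProd q t (q ^ κ i * u i) (q ^ κ j * u j) (m i)
          * downProd q t (q ^ κ j * u j) (q ^ κ i * u i) (m j)) := by
    refine prod_congr rfl fun i _ => prod_congr rfl fun j hj => ?_
    have hij : i ≠ j := (mem_Ioi.1 hj).ne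
    rw [hd, g_pair hq ht (h.u_ne_zero i) (h.u_ne_zero j) (h.u_div_avoids i j hij)
      (h.u_div_t_avoids hij) (hm i) (hm j), zpow_sub₀ ht, zpow_sub₀ hq]
    simp only [div_eq_mul_inv, mul_inv, inv_inv]
    ring
  have hpow : (q / t) ^ (size κ - size γ) * ∏ i, (q ^ m i)⁻¹
      = (∏ i, (t ^ κ i)⁻¹) * (∏ i, t ^ γ i) := by
    have hqt : q / t ≠ 0 := div_ne_zero hq ht
    rw [zpow_sub₀ hqt, zpow_size hqt, zpow_size hqt, ← prod_div_distrib, ← prod_mul_distrib,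
      ← prod_mul_distrib]
    refine prod_congr rfl fun i _ => ?_
    rw [← zpow_natCast q, ← hd, zpow_sub₀ hq, div_zpow, div_zpow]
    field_simp
  have htheta : ∏ i, theta q t u κ i (κ i - γ i).toNat
      = (∏ i, (qPoch q (q ^ (γ i + size κ + 1) * u i) (m i)
          / qPoch q (q ^ (γ i + size κ) * t * u i) (m i))) *
      ((∏ i, downProd q t (q ^ κ i * u i) (q ^ κ i * u i) (m i)) *
        ∏ i, ∏ j ∈ Ioi i, downProd q t (q ^ κ i * u i) (q ^ κ j * u j) (m i)
          * downProd q t (q ^ κ j * u j) (q ^ κ i * u i) (m j)) := by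
    rw [← prod_prod_eq_diag_mul fun i j => downProd q t (q ^ κ i * u i) (q ^ κ j * u j) (m i),
      ← prod_mul_distrib]
    refine prod_congr rfl fun i _ => ?_
    rw [hd, Int.toNat_natCast, theta_eq hq κ i (m i) (hm i)]
  rw [g₀, hdiag, hpair, htheta, g₀Row, g₀Col]
  simp only [prod_mul_distrib] at hpow ⊢
  linear_combination (∏ i, downProd q t (q ^ κ i * u i) (q ^ κ i * u i) (m i))
      * (∏ i, (qPoch q (q ^ (γ i + size κ + 1) * u i) (m i)
          / qPoch q (q ^ (γ i + size κ) * t * u i) (m i)))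
      * ((∏ i : Fin n, ∏ j ∈ Finset.Ioi i, (t ^ κ i)⁻¹)
        * (∏ i : Fin n, ∏ j ∈ Finset.Ioi i, (q ^ κ j)⁻¹)
        * (∏ i : Fin n, ∏ j ∈ Finset.Ioi i, sigma q t (u i / u j) (κ i - κ j))
        * ((∏ i : Fin n, ∏ j ∈ Finset.Ioi i, t ^ γ i)
          * (∏ i : Fin n, ∏ j ∈ Finset.Ioi i, q ^ γ j)
          * (∏ i : Fin n, ∏ j ∈ Finset.Ioi i, (sigma q t (u i / u j) (γ i - γ j))⁻¹))
        * ((∏ i : Fin n, ∏ j ∈ Finset.Ioi i, downProd q t (q ^ κ i * u i) (q ^ κ j * u j) (m i))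
          * (∏ i : Fin n, ∏ j ∈ Finset.Ioi i,
            downProd q t (q ^ κ j * u j) (q ^ κ i * u i) (m j)))) * hpow

/-- Apart from `theta`, `eta` and the determinant, the summand of the matrix product depends on the
summation index through a monomial only. -/
lemma g₀Col_mul_f₀Row (h : Generic q t u) (β : Fin n → ℤ) :
    g₀Col q t u β * f₀Row q t u β
      = (∏ i, (u i)⁻¹) * (∏ i, ∏ j ∈ Ioi i, -((1 - u i / u j) * u j)⁻¹) * ∏ i, q ^ β i * u i := by
  have hq := h.q_ne_zero
  have ht := h.t_ne_zero
  have h1 : (∏ i, t ^ β i) * ∏ i, (q / t) ^ β i = (∏ i, (u i)⁻¹) * ∏ i, q ^ β i * u i := by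
    rw [← prod_mul_distrib, ← prod_mul_distrib]
    refine prod_congr rfl fun i _ => ?_
    have := h.u_ne_zero i
    rw [div_zpow]
    field_simp
  have h2 : (∏ i, ∏ j ∈ Ioi i, t ^ β i * q ^ β j * (sigma q t (u i / u j) (β i - β j))⁻¹)
      * (∏ i, ∏ j ∈ Ioi i, (t ^ β i)⁻¹ * rho q t (u i / u j) (β i - β j)
        * (q ^ β i * u i - q ^ β j * u j)⁻¹)
      = ∏ i, ∏ j ∈ Ioi i, -((1 - u i / u j) * u j)⁻¹ := by
    simp only [← prod_mul_distrib]
    refine prod_congr rfl fun i _ => prod_congr rfl fun j hj => ?_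
    have hij : i ≠ j := (mem_Ioi.1 hj).ne
    have hz := h.u_div_avoids i j hij
    have hr := rho_div_sigma hq hz
      ((h.u_div_t_avoids hij).mul_zpow hq 0 (by rw [zpow_zero, mul_one, div_div, mul_comm t]))
      (β i - β j)
    have hj0 := h.u_ne_zero j
    have hn := hz.one_sub_ne_zero (β i - β j)
    have he : q ^ β i * u i - q ^ β j * u j
        = -(q ^ β j * u j) * (1 - u i / u j * q ^ (β i - β j)) := by
      rw [zpow_sub₀ hq]; field_simp; ring
    calc _ = q ^ β j * (rho q t (u i / u j) (β i - β j) / sigma q t (u i / u j) (β i - β j))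
          * (q ^ β i * u i - q ^ β j * u j)⁻¹ := by field_simp
      _ = _ := by
        rw [hr, he]
        generalize 1 - u i / u j * q ^ (β i - β j) = A at *
        generalize 1 - u i / u j = B at *
        field_simp
  rw [g₀Col, f₀Row, ← h2, mul_mul_mul_comm, h1]
  ring

end

/-! ### The polynomials `P_κ` and the vanishing off the diagonal -/

section

variable {n : ℕ} (q t : K) (u : Fin n → K)

/-- The polynomial `P_κ` with roots `q ^ κ_s u_s`, `1 ≤ s ≤ n`, and `q ^ (-|κ|) / t`. The last root
makes the constant coefficient independent of `κ`. -/
def nodePoly (κ : Fin n → ℤ) : K[X] :=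
  (X - C ((q ^ size κ)⁻¹ / t)) * ∏ s, (X - C (q ^ κ s * u s))

lemma nodePoly_monic (κ : Fin n → ℤ) : (nodePoly q t u κ).Monic :=
  (monic_X_sub_C _).mul (monic_prod_of_monic _ _ fun _ _ => monic_X_sub_C _)

lemma natDegree_nodePoly (κ : Fin n → ℤ) : (nodePoly q t u κ).natDegree = n + 1 := by
  rw [nodePoly, Monic.natDegree_mul (monic_X_sub_C _)
    (monic_prod_of_monic _ _ fun _ _ => monic_X_sub_C _),
    natDegree_prod_of_monic _ _ fun _ _ => monic_X_sub_C _]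
  simp only [natDegree_X_sub_C, sum_const, card_univ, Fintype.card_fin, smul_eq_mul, mul_one]
  exact add_comm 1 n

lemma eval_nodePoly (κ : Fin n → ℤ) (x : K) : (nodePoly q t u κ).eval x
    = (x - (q ^ size κ)⁻¹ / t) * ∏ s, (x - q ^ κ s * u s) := by
  simp [nodePoly, eval_prod]

variable {q t u}

lemma coeff_zero_nodePoly (hq : q ≠ 0) (κ : Fin n → ℤ) :
    (nodePoly q t u κ).coeff 0 = -t⁻¹ * ∏ s, -u s := by
  have h := zpow_ne_zero (size κ) hq
  have h2 : ∏ s, (0 - q ^ κ s * u s) = q ^ size κ * ∏ s, -u s := by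
    rw [zpow_size hq, ← prod_mul_distrib]
    exact prod_congr rfl fun s _ => by ring
  rw [coeff_zero_eq_eval_zero, eval_nodePoly, h2]
  field_simp
  ring

lemma Generic.node_ne (h : Generic q t u) {i s : Fin n} (his : i ≠ s) (b c : ℤ) :
    q ^ b * u i - q ^ c * u s ≠ 0 := by
  intro h0
  apply h.u_div_avoids i s his (b - c)
  have h1 := zpow_ne_zero c h.q_ne_zero
  have h2 := h.u_ne_zero s
  rw [zpow_sub₀ h.q_ne_zero]
  field_simp
  linear_combination h0

lemma Generic.zpow_ne (h : Generic q t u) (i : Fin n) {b c : ℤ} (hbc : b ≠ c) :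
    q ^ b * u i - q ^ c * u i ≠ 0 := by
  intro h0
  apply h.zpow_ne_one (b - c) (sub_ne_zero.2 hbc)
  have h1 := zpow_ne_zero c h.q_ne_zero
  rw [← sub_mul] at h0
  rw [zpow_sub₀ h.q_ne_zero, div_eq_one_iff_eq h1]
  exact sub_eq_zero.1 ((mul_eq_zero.1 h0).resolve_right (h.u_ne_zero i))

lemma Generic.t_node_ne (h : Generic q t u) (i s : Fin n) (b c : ℤ) :
    q ^ b * u i - q ^ c * t * u s ≠ 0 := by
  intro h0
  have h1 := zpow_ne_zero b h.q_ne_zero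
  have h2 := h.u_ne_zero i
  by_cases his : s = i
  · subst his
    apply h.t_avoids (c - b)
    rw [zpow_sub₀ h.q_ne_zero]
    field_simp
    apply mul_right_cancel₀ h2
    linear_combination -h0
  · apply h.t_mul_u_div_avoids s i his (c - b)
    rw [zpow_sub₀ h.q_ne_zero]
    field_simp
    linear_combination -h0

lemma phi_mul (h : Generic q t u) (κ : Fin n → ℤ) (i : Fin n) (b : ℤ) :
    phi q t u κ i b * (t ^ n * (nodePoly q t u κ).eval (q ^ b * u i / t))
      = (nodePoly q t u κ).eval (q ^ b * u i) := by
  have ht := h.t_ne_zero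
  have hQ := zpow_ne_zero (size κ) h.q_ne_zero
  have h1 : 1 - q ^ (b + size κ) * u i ≠ 0 := by
    rw [mul_comm]; exact (h.u_avoids i).one_sub_ne_zero _
  have h2 : t ^ n * ∏ s, (q ^ b * u i / t - q ^ κ s * u s)
      = ∏ s, (q ^ b * u i - q ^ κ s * t * u s) := by
    have : t ^ n = ∏ _s : Fin n, t := by simp
    rw [this, ← prod_mul_distrib]
    exact prod_congr rfl fun s _ => by field_simp
  have h3 : ∏ s, (q ^ b * u i - q ^ κ s * t * u s) ≠ 0 :=
    prod_ne_zero_iff.2 fun s _ => h.t_node_ne i s _ _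
  rw [eval_nodePoly, eval_nodePoly, phi, prod_div_distrib, mul_left_comm (t ^ n), h2]
  rw [zpow_add₀ h.q_ne_zero] at h1 ⊢
  generalize ∏ s, (q ^ b * u i - q ^ κ s * t * u s) = A at *
  generalize ∏ s, (q ^ b * u i - q ^ κ s * u s) = B at *
  generalize q ^ size κ = Q at *
  generalize q ^ b = y at *
  field_simp
  ring

lemma psi_mul (h : Generic q t u) (κ : Fin n → ℤ) (i : Fin n) {b : ℤ} (hb : b ≠ κ i) :
    psi q t u κ i b * (nodePoly q t u κ).eval (q ^ b * u i)
      = t ^ n * (nodePoly q t u κ).eval (q ^ (b + 1) * u i / t) := by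
  have ht := h.t_ne_zero
  have hQ := zpow_ne_zero (size κ) h.q_ne_zero
  have h1 : 1 - q ^ (b + size κ) * t * u i ≠ 0 := by
    have := (h.t_mul_u_avoids i).one_sub_ne_zero (b + size κ)
    rwa [mul_comm, ← mul_assoc] at this
  have h2 : t ^ n * ∏ s, (q ^ (b + 1) * u i / t - q ^ κ s * u s)
      = ∏ s, (q ^ (b + 1) * u i - q ^ κ s * t * u s) := by
    have : t ^ n = ∏ _s : Fin n, t := by simp
    rw [this, ← prod_mul_distrib]
    exact prod_congr rfl fun s _ => by field_simp
  have h3 : ∏ s, (q ^ b * u i - q ^ κ s * u s) ≠ 0 := by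
    refine prod_ne_zero_iff.2 fun s _ => ?_
    rcases eq_or_ne i s with rfl | his
    · exact h.zpow_ne i hb
    · exact h.node_ne his _ _
  rw [eval_nodePoly, eval_nodePoly, psi, prod_div_distrib, mul_left_comm (t ^ n), h2,
    zpow_add₀ h.q_ne_zero (b + 1) (size κ)]
  rw [zpow_add₀ h.q_ne_zero b (size κ)] at h1 ⊢
  generalize ∏ s, (q ^ (b + 1) * u i - q ^ κ s * t * u s) = A at *
  generalize ∏ s, (q ^ b * u i - q ^ κ s * u s) = B at *
  generalize q ^ size κ = Q at *
  generalize q ^ (b + 1) = y' at *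
  generalize q ^ b = y at *
  have h4 : y * u i - Q⁻¹ / t = -(Q⁻¹ / t) * (1 - y * Q * t * u i) := by
    field_simp
    ring
  rw [h4]
  generalize 1 - y * Q * t * u i = D at *
  field_simp
  ring

lemma phi_self (κ : Fin n → ℤ) (i : Fin n) : phi q t u κ i (κ i) = 0 := by
  rw [phi, prod_eq_zero (mem_univ i), mul_zero]
  simp

lemma phi_ne_zero (h : Generic q t u) (κ : Fin n → ℤ) (i : Fin n) {b : ℤ} (hb : b ≠ κ i) :
    phi q t u κ i b ≠ 0 := by
  have h0 := (h.t_mul_u_avoids i).one_sub_ne_zero (b + size κ)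
  rw [mul_comm, ← mul_assoc] at h0
  refine mul_ne_zero (div_ne_zero h0 ?_)
    (prod_ne_zero_iff.2 fun s _ => div_ne_zero ?_ (h.t_node_ne i s _ _))
  · rw [mul_comm]; exact (h.u_avoids i).one_sub_ne_zero _
  · rcases eq_or_ne i s with rfl | his
    · exact h.zpow_ne i hb
    · exact h.node_ne his _ _

lemma eval_nodePoly_self (κ : Fin n → ℤ) (i : Fin n) :
    (nodePoly q t u κ).eval (q ^ κ i * u i) = 0 := by
  rw [eval_nodePoly, prod_eq_zero (mem_univ i) (sub_self _), mul_zero]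

lemma nodePoly_injective (h : Generic q t u) {κ γ : Fin n → ℤ}
    (hP : nodePoly q t u κ = nodePoly q t u γ) : κ = γ := by
  funext i
  by_contra hne
  have h0 := eval_nodePoly_self (q := q) (t := t) (u := u) κ i
  rw [hP, eval_nodePoly] at h0
  rcases mul_eq_zero.1 h0 with h1 | h1
  · apply h.t_mul_u_avoids i (size γ + κ i)
    have := zpow_ne_zero (size γ) h.q_ne_zero
    have ht := h.t_ne_zero
    rw [zpow_add₀ h.q_ne_zero]
    rw [sub_eq_zero] at h1
    calc _ = t * q ^ size γ * (q ^ κ i * u i) := by ring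
      _ = 1 := by rw [h1]; field_simp
  · obtain ⟨s, -, hs⟩ := prod_eq_zero_iff.1 h1
    rcases eq_or_ne i s with rfl | his
    · exact h.zpow_ne i hne hs
    · exact h.node_ne his _ _ hs

/-- Off the diagonal the product of the reduced matrices vanishes. -/
theorem sum_g₀_mul_f₀_of_ne (h : Generic q t u) {β γ : Fin n → ℤ} (hle : γ ≤ β) (hne : γ ≠ β) :
    ∑ κ ∈ Icc γ β, g₀ q t u β κ * f₀ q t u κ γ = 0 := by
  set c : K := g₀Row q t u β * f₀Col q t u γ
    * ((∏ i, (u i)⁻¹) * (∏ i, ∏ j ∈ Ioi i, -((1 - u i / u j) * u j)⁻¹))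
  have hterm : ∀ κ ∈ Icc γ β, g₀ q t u β κ * f₀ q t u κ γ = c *
      ((∏ i, q ^ κ i * u i * eta q t u γ i (κ i - γ i).toNat * theta q t u β i (β i - κ i).toNat)
      * Matrix.det (Matrix.of fun i j : Fin n =>
        (q ^ κ i * u i) ^ (n - 1 - (j : ℕ)) * (1 - t ^ (j : ℕ) * phi q t u γ i (κ i)))) := by
    intro κ hκ
    obtain ⟨h1, h2⟩ := mem_Icc.1 hκ
    rw [g₀_eq h h2, f₀_eq h h1, prod_mul_distrib, prod_mul_distrib]
    linear_combination (∏ i, eta q t u γ i (κ i - γ i).toNat)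
      * (∏ i, theta q t u β i (β i - κ i).toNat) * g₀Row q t u β * f₀Col q t u γ
      * Matrix.det (Matrix.of fun i j : Fin n =>
        (q ^ κ i * u i) ^ (n - 1 - (j : ℕ)) * (1 - t ^ (j : ℕ) * phi q t u γ i (κ i)))
      * g₀Col_mul_f₀Row h κ
  rw [sum_congr rfl hterm, ← mul_sum,
    sum_Icc_det γ β (fun i b => q ^ b * u i * eta q t u γ i (b - γ i).toNat
      * theta q t u β i (β i - b).toNat)
      (fun i b j => (q ^ b * u i) ^ (n - 1 - (j : ℕ)) * (1 - t ^ (j : ℕ) * phi q t u γ i b)),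
    det_sum_eq_zero (x := fun i b => q ^ b * u i) (φ := phi q t u γ)
      (η := fun i b => eta q t u γ i (b - γ i).toNat)
      (θ := fun i b => theta q t u β i (β i - b).toNat) h.t_ne_zero
      (nodePoly_monic q t u γ) (nodePoly_monic q t u β) (natDegree_nodePoly q t u γ)
      (natDegree_nodePoly q t u β) (by rw [coeff_zero_nodePoly h.q_ne_zero,
        coeff_zero_nodePoly h.q_ne_zero]) (fun hP => hne (nodePoly_injective h hP)) hle
      (fun i b _ _ => phi_mul h γ i b) (phi_self γ) ?_ ?_ (eval_nodePoly_self β), mul_zero]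
  · intro i b hb
    obtain ⟨m, rfl⟩ := Int.le.dest hb
    have e1 : (γ i + m + 1 - γ i).toNat = m + 1 := by omega
    have e2 : (γ i + m - γ i).toNat = m := by omega
    simp only [e1, e2, eta]
    rw [prod_range_succ, mul_assoc, ← add_assoc (γ i),
      inv_mul_cancel₀ (phi_ne_zero h γ i (by omega)), mul_one]
  · intro i b hb
    obtain ⟨m, hm⟩ := Int.le.dest (Int.add_one_le_iff.2 hb)
    have e1 : (β i - b).toNat = m + 1 := by omega
    have e2 : (β i - (b + 1)).toNat = m := by omega
    have e3 : β i - (m + 1) = b := by omega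
    simp only [e1, e2, theta]
    rw [prod_range_succ, e3, mul_assoc, psi_mul h β i hb.ne]

lemma det_eq_prod (x : Fin n → K) :
    Matrix.det (Matrix.of fun i j : Fin n => x i ^ (n - 1 - (j : ℕ)))
      = ∏ i, ∏ j ∈ Ioi i, (x i - x j) := by
  have h := Matrix.det_projVandermonde (fun _ => (1 : K)) x
  simp only [one_mul] at h
  rw [← h]
  congr 1
  ext i j
  simp only [Matrix.of_apply, Matrix.projVandermonde, Matrix.rectVandermonde, one_pow, one_mul,
    Fin.val_rev]
  congr 1
  omega

lemma qPochSelfRecip_zero : qPochSelfRecip q 0 = 1 := by simp [qPochSelfRecip, qPoch_zero]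

lemma f₀_self (h : Generic q t u) (κ : Fin n → ℤ) : f₀ q t u κ κ = 1 := by
  have hdet : Matrix.det (Matrix.of fun i j : Fin n =>
      (q ^ κ i * u i) ^ (n - 1 - (j : ℕ))
      * (1 - t ^ (j : ℕ)
          * ((1 - q ^ (κ i + size κ) * t * u i) / (1 - q ^ (κ i + size κ) * u i))
          * ∏ s : Fin n, (q ^ κ i * u i - q ^ κ s * u s) / (q ^ κ i * u i - q ^ κ s * t * u s)))
      = ∏ i, ∏ j ∈ Ioi i, (q ^ κ i * u i - q ^ κ j * u j) := by
    rw [← det_eq_prod]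
    congr 1
    ext i j
    simp only [Matrix.of_apply]
    rw [prod_eq_zero (mem_univ i) (by rw [sub_self, zero_div]), mul_zero, sub_zero, mul_one]
  rw [f₀, hdet]
  simp only [sub_self, zpow_zero, qPoch_zero, qPochSelfRecip_zero, div_one, mul_one, one_mul,
    prod_const_one]
  simp only [← prod_mul_distrib]
  refine prod_eq_one fun i _ => prod_eq_one fun j hj => ?_
  exact inv_mul_cancel₀ (h.node_ne (mem_Ioi.1 hj).ne _ _)

lemma g₀_self (κ : Fin n → ℤ) : g₀ q t u κ κ = 1 := by
  simp [g₀, qPoch_zero, qPochSelfRecip_zero]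

lemma qPochSelfRecip_of_neg {m : ℤ} (hm : m < 0) : qPochSelfRecip q m = 0 :=
  if_neg (by omega)

variable (q t u)

lemma isLowerTriangular_f (u₀ : K) (r k : ℕ) : IsLowerTriangular (f q t u₀ u r k) := by
  intro β κ hle
  obtain ⟨i, hi⟩ := not_forall.1 hle
  have hi := not_le.1 hi
  have h0 := prod_eq_zero (mem_univ i) (f := fun i : Fin n =>
      (qPoch q (q / t) (β i - κ i) * qPochSelfRecip q (β i - κ i))
      * (qPoch q (q ^ (κ i + size κ + 1) * u i) (β i - κ i)
          / qPoch q (q ^ (κ i + size κ + 1) * t * u i) (β i - κ i)))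
    (by rw [qPochSelfRecip_of_neg (sub_neg_of_lt hi)]; ring)
  simp only [f, h0, mul_zero, zero_mul]

lemma isLowerTriangular_g (u₀ : K) (r k : ℕ) : IsLowerTriangular (g q t u₀ u r k) := by
  intro κ γ hle
  obtain ⟨i, hi⟩ := not_forall.1 hle
  have hi := not_le.1 hi
  have h0 := prod_eq_zero (mem_univ i) (f := fun i : Fin n =>
      (qPoch q t (κ i - γ i) * qPochSelfRecip q (κ i - γ i))
      * (qPoch q (q ^ (γ i + size κ + 1) * u i) (κ i - γ i)
          / qPoch q (q ^ (γ i + size κ) * t * u i) (κ i - γ i)))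
    (by rw [qPochSelfRecip_of_neg (sub_neg_of_lt hi)]; ring)
  simp only [g, h0, mul_zero, zero_mul]

end

/-! ### Inverses of lower-triangular matrices -/

/-- For lower-triangular matrices a left inverse is a right inverse: this reduces to square matrices
indexed by a box. -/
theorem mul_eq_comm_of_isLowerTriangular {n : ℕ} {F G : (Fin n → ℤ) → (Fin n → ℤ) → K}
    (hF : IsLowerTriangular F) (hG : IsLowerTriangular G)
    (h : ∀ β γ, ∑ κ ∈ Icc γ β, G β κ * F κ γ = if β = γ then 1 else 0) (β γ : Fin n → ℤ) :
    ∑ κ ∈ Icc γ β, F β κ * G κ γ = if β = γ then 1 else 0 := by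
  by_cases hle : γ ≤ β
  swap
  · rw [Icc_eq_empty hle, sum_empty, if_neg]
    rintro rfl
    exact hle le_rfl
  -- By triangularity the sum over the box reduces to the interval between the two indices.
  have key : ∀ {A B : (Fin n → ℤ) → (Fin n → ℤ) → K}, IsLowerTriangular A → IsLowerTriangular B →
      ∀ b c : Icc γ β, ∑ κ : Icc γ β, A b κ * B κ c
        = ∑ κ ∈ Icc (c : Fin n → ℤ) b, A b κ * B κ c := by
    intro A B hA hB b c
    have hb := (mem_Icc.1 b.2).2
    have hc := (mem_Icc.1 c.2).1
    rw [Finset.sum_coe_sort (Icc γ β) fun κ => A b κ * B κ c]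
    refine (sum_subset (Icc_subset_Icc hc hb) fun κ _ hκ => ?_).symm
    rw [mem_Icc, not_and_or] at hκ
    rcases hκ with hκ | hκ
    · rw [hB _ _ hκ, mul_zero]
    · rw [hA _ _ hκ, zero_mul]
  have hGF : (Matrix.of fun b c : Icc γ β => G b c)
      * (Matrix.of fun b c : Icc γ β => F b c) = 1 := by
    ext b c
    rw [Matrix.mul_apply, Matrix.one_apply]
    simp only [Matrix.of_apply]
    rw [key hG hF, h]
    simp only [Subtype.ext_iff]
  have hFG := mul_eq_one_comm.1 hGF
  set b : Icc γ β := ⟨β, mem_Icc.2 ⟨hle, le_rfl⟩⟩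
  set c : Icc γ β := ⟨γ, mem_Icc.2 ⟨le_rfl, hle⟩⟩
  have hbc := congrFun (congrFun hFG b) c
  rw [Matrix.mul_apply, Matrix.one_apply] at hbc
  simpa only [Subtype.ext_iff] using (key hF hG b c).symm.trans hbc

theorem areMutuallyInverse_of_generic {n : ℕ} {q t u₀ : K} {u : Fin n → K} {r k : ℕ}
    (h : Generic q t u) (hrow : ∀ κ, rowFactor q t u u₀ k κ ≠ 0)
    (hcol : ∀ κ, colFactor q t u u₀ r k κ ≠ 0) :
    AreMutuallyInverse (f q t u₀ u r k) (g q t u₀ u r k) := by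
  have hmul : ∀ β γ, ∑ κ ∈ Icc γ β, g q t u₀ u r k β κ * f q t u₀ u r k κ γ
      = if β = γ then 1 else 0 := by
    intro β γ
    have hterm : ∀ κ, g q t u₀ u r k β κ * f q t u₀ u r k κ γ
        = (colFactor q t u u₀ r k β)⁻¹ * colFactor q t u u₀ r k γ
          * (g₀ q t u β κ * f₀ q t u κ γ) := by
      intro κ
      rw [f_eq_conj, g_eq_conj]
      have := hrow κ
      field_simp
    simp only [hterm, ← mul_sum]
    split_ifs with hβγ
    · subst hβγ
      simp [f₀_self h, g₀_self, hcol β]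
    · by_cases hle : γ ≤ β
      · rw [sum_g₀_mul_f₀_of_ne h hle (Ne.symm hβγ), mul_zero]
      · rw [Icc_eq_empty hle, sum_empty, mul_zero]
  have hf := isLowerTriangular_f q t u u₀ r k
  have hg := isLowerTriangular_g q t u u₀ r k
  refine ⟨hf, hg, fun κ => ?_, fun κ => ?_, mul_eq_comm_of_isLowerTriangular hf hg hmul, hmul⟩
  · rw [f_eq_conj, f₀_self h, mul_one]
    exact mul_ne_zero (hrow κ) (hcol κ)
  · rw [g_eq_conj, g₀_self, mul_one]
    exact mul_ne_zero (inv_ne_zero (hcol κ)) (inv_ne_zero (hrow κ))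

/-! ### Genericity of algebraically independent parameters -/

section

variable {R : Type*} [Field R] [Algebra R K] {ι : Type*} {v : ι → K}

/-- A quotient of two different monomials in algebraically independent elements is not a constant,
hence not a power of `q`. -/
lemma avoids_of_algebraicIndependent (hind : AlgebraicIndependent R v) {q : R}
    (a b : ι →₀ ℕ) (hab : a ≠ b) {x : K}
    (hx : x = (a.prod fun i e => v i ^ e) / b.prod fun i e => v i ^ e) :
    Avoids (algebraMap R K q) x := by
  intro m hm
  have hb : (b.prod fun i e => v i ^ e) ≠ 0 := by
    intro h0
    rw [h0, div_zero] at hx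
    simp [hx] at hm
  rw [hx, ← map_zpow₀] at hm
  have h1 : MvPolynomial.aeval v (MvPolynomial.monomial a (q ^ m))
      = MvPolynomial.aeval v (MvPolynomial.monomial b (1 : R)) := by
    rw [MvPolynomial.aeval_monomial, MvPolynomial.aeval_monomial, map_one, one_mul]
    field_simp at hm
    linear_combination hm
  have h2 := hind h1
  rw [MvPolynomial.monomial_eq_monomial_iff] at h2
  rcases h2 with h2 | h2
  · exact hab h2.1
  · exact one_ne_zero h2.2

end

section

variable {n : ℕ} {q t u₀ : K} {u : Fin n → K}

lemma rowFactor_ne_zero (k : ℕ) (h1 : Avoids q (t ^ 2 * u₀)) (h2 : Avoids q (q * t * u₀))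
    (h3 : ∀ i, Avoids q (u i / (t * u₀))) (h4 : ∀ i, Avoids q (q * u i / (t ^ 2 * u₀)))
    (h5 : ∀ i, Avoids q (t * u i / u₀)) (h6 : ∀ i, Avoids q (q * u i / u₀)) (κ : Fin n → ℤ) :
    rowFactor q t u u₀ k κ ≠ 0 :=
  mul_ne_zero (mul_ne_zero (div_ne_zero (qPoch_ne_zero h1 _) (qPoch_ne_zero h2 _))
    (prod_ne_zero_iff.2 fun i _ => div_ne_zero (qPoch_ne_zero (h3 i) _) (qPoch_ne_zero (h4 i) _)))
    (prod_ne_zero_iff.2 fun i _ => div_ne_zero (qPoch_ne_zero (h5 i) _) (qPoch_ne_zero (h6 i) _))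

lemma colFactor_ne_zero (r k : ℕ) (h1 : Avoids q (t ^ 2 * u₀)) (h2 : Avoids q (q * t * u₀))
    (h3 : ∀ i, Avoids q (u i / (t * u₀))) (h4 : ∀ i, Avoids q (q * u i / (t ^ 2 * u₀)))
    (h5 : ∀ i, Avoids q (t * u i / u₀)) (h6 : ∀ i, Avoids q (q * u i / u₀))
    (h7 : ∀ i, Avoids q (q * u i / (t * u₀))) (h8 : ∀ i, Avoids q (u i / u₀)) (κ : Fin n → ℤ) :
    colFactor q t u u₀ r k κ ≠ 0 :=
  mul_ne_zero (mul_ne_zero (div_ne_zero (qPoch_ne_zero h2 _) (qPoch_ne_zero h1 _))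
    (prod_ne_zero_iff.2 fun i _ => mul_ne_zero (mul_ne_zero
      (div_ne_zero (qPoch_ne_zero (h7 i) _) (qPoch_ne_zero (h8 i) _))
      (div_ne_zero (qPoch_ne_zero (h8 i) _) (qPoch_ne_zero (h7 i) _)))
      (div_ne_zero (qPoch_ne_zero (h4 i) _) (qPoch_ne_zero (h3 i) _))))
    (prod_ne_zero_iff.2 fun i _ => div_ne_zero (qPoch_ne_zero (h6 i) _) (qPoch_ne_zero (h5 i) _))

end

end QInverse

end

open QInverse in
theorem mainTheorem5 {R K : Type*} [Field R] [Field K] [Algebra R K]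
    (q : R) (hq0 : q ≠ 0) (hq : ∀ m : ℕ, 0 < m → q ^ m ≠ 1)
    (n : ℕ) (t u₀ : K) (u : Fin n → K)
    (hind : AlgebraicIndependent R (Fin.cons t (Fin.cons u₀ u) : Fin (n + 2) → K))
    (r k : ℕ) (hk1 : 1 ≤ k) (hkn : k ≤ n + 1) :
    QInverse.AreMutuallyInverse
      (QInverse.f (algebraMap R K q) t u₀ u r k)
      (QInverse.g (algebraMap R K q) t u₀ u r k) := by
  set v : Fin (n + 2) → K := Fin.cons t (Fin.cons u₀ u) with hv
  have hq0' : algebraMap R K q ≠ 0 := by simpa using hq0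
  have ht0 : t ≠ 0 := hind.ne_zero 0
  have hu (i : Fin n) : u i ≠ 0 := hind.ne_zero i.succ.succ
  have hpow (m : ℤ) (hm : m ≠ 0) : algebraMap R K q ^ m ≠ 1 := by
    have hnat (m : ℕ) (hm : 0 < m) : algebraMap R K q ^ m ≠ 1 := by
      rw [← map_pow]
      exact fun h => hq m hm ((algebraMap R K).injective (h.trans (map_one _).symm))
    rcases Int.eq_nat_or_neg m with ⟨m, rfl | rfl⟩
    · rw [zpow_natCast]
      exact hnat m (by omega)
    · rw [zpow_neg, zpow_natCast, inv_ne_one]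
      exact hnat m (by omega)
  -- A quotient of monomials with different exponent vectors is not a power of `q`.
  have key := fun (e e' : Fin (n + 2) → ℕ) (hne : e ≠ e') (x : K)
      (hx : x = (∏ i, v i ^ e i) / ∏ i, v i ^ e' i) =>
    avoids_of_algebraicIndependent hind (q := q) (Finsupp.equivFunOnFinite.symm e)
      (Finsupp.equivFunOnFinite.symm e') (fun h => hne (Finsupp.equivFunOnFinite.symm.injective h))
      (x := x) (by
        rw [hx, Finsupp.prod_fintype _ _ fun _ => pow_zero _,
          Finsupp.prod_fintype _ _ fun _ => pow_zero _]
        rfl)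
  -- The same with the exponents of `t`, `u₀` and `u` listed separately.
  have mono (a b a' b' : ℕ) (w w' : Fin n → ℕ) (hne : a ≠ a' ∨ b ≠ b' ∨ w ≠ w') (x : K)
      (hx : x = (t ^ a * (u₀ ^ b * ∏ i, u i ^ w i)) / (t ^ a' * (u₀ ^ b' * ∏ i, u i ^ w' i))) :
      Avoids (algebraMap R K q) x := by
    refine key (Fin.cons a (Fin.cons b w)) (Fin.cons a' (Fin.cons b' w')) ?_ x ?_
    · simp only [ne_eq, Fin.cons_inj]
      tauto
    · simp only [Fin.prod_univ_succ, hv, Fin.cons_zero, Fin.cons_succ, hx]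
  have hsingle (i : Fin n) : ∏ j, u j ^ (Pi.single i 1 : Fin n → ℕ) j = u i := by
    rw [Finset.prod_eq_single i (fun j _ hj => by simp [hj]) (by simp)]
    simp
  have hs0 (i : Fin n) : (Pi.single i 1 : Fin n → ℕ) ≠ 0 := by simp
  have hss {i j : Fin n} (hij : i ≠ j) : (Pi.single i 1 : Fin n → ℕ) ≠ Pi.single j 1 := by
    intro h
    simpa [hij] using congrFun h i
  have mulq {x y : K} (hx : Avoids (algebraMap R K q) x) (hy : y = x * algebraMap R K q) :
      Avoids (algebraMap R K q) y := hx.mul_zpow hq0' 1 (by rw [zpow_one, hy])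
  have hgen : Generic (algebraMap R K q) t u :=
    { q_ne_zero := hq0'
      t_ne_zero := ht0
      u_ne_zero := hu
      zpow_ne_one := hpow
      t_avoids := mono 1 0 0 0 0 0 (by simp) _ (by simp)
      u_avoids := fun i => mono 0 0 0 0 (Pi.single i 1) 0 (by simp [hs0]) _
        (by rw [hsingle]; simp)
      t_mul_u_avoids := fun i => mono 1 0 0 0 (Pi.single i 1) 0 (by simp) _
        (by rw [hsingle]; simp)
      u_div_avoids := fun i j hij => mono 0 0 0 0 (Pi.single i 1) (Pi.single j 1)
        (by simp [hss hij]) _ (by rw [hsingle, hsingle]; simp)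
      t_mul_u_div_avoids := fun i j hij => mono 1 0 0 0 (Pi.single i 1) (Pi.single j 1)
        (by simp) _ (by rw [hsingle, hsingle]; simp) }
  have h1 : Avoids (algebraMap R K q) (t ^ 2 * u₀) := mono 2 1 0 0 0 0 (by simp) _ (by simp)
  have h2 : Avoids (algebraMap R K q) (t * u₀) := mono 1 1 0 0 0 0 (by simp) _ (by simp)
  have h3 (i : Fin n) : Avoids (algebraMap R K q) (u i / (t * u₀)) :=
    mono 0 0 1 1 (Pi.single i 1) 0 (by simp) _ (by rw [hsingle]; simp)
  have h4 (i : Fin n) : Avoids (algebraMap R K q) (u i / (t ^ 2 * u₀)) :=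
    mono 0 0 2 1 (Pi.single i 1) 0 (by simp) _ (by rw [hsingle]; simp)
  have h5 (i : Fin n) : Avoids (algebraMap R K q) (t * u i / u₀) :=
    mono 1 0 0 1 (Pi.single i 1) 0 (by simp) _ (by rw [hsingle]; simp)
  have h6 (i : Fin n) : Avoids (algebraMap R K q) (u i / u₀) :=
    mono 0 0 0 1 (Pi.single i 1) 0 (by simp) _ (by rw [hsingle]; simp)
  have h2' := mulq h2 (y := algebraMap R K q * t * u₀) (by ring)
  have h3' (i : Fin n) := mulq (h3 i) (y := algebraMap R K q * u i / (t * u₀)) (by ring)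
  have h4' (i : Fin n) := mulq (h4 i) (y := algebraMap R K q * u i / (t ^ 2 * u₀)) (by ring)
  have h6' (i : Fin n) := mulq (h6 i) (y := algebraMap R K q * u i / u₀) (by ring)
  exact areMutuallyInverse_of_generic hgen (rowFactor_ne_zero k h1 h2' h3 h4' h5 h6')
    (colFactor_ne_zero r k h1 h2' h3 h4' h5 h6' h3' h6)
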